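/- \textbf{Logic.} Monadic higher-order logic has a sort for each $n=0,1,2,\dots$ (sort $n+1$ being thought of as the power set of sort $n$), function symbols and relation symbols with sorted arguments, and the relation symbols $=^n$ (on sort $n$) and $\in^n$ (between sorts $n$ and $n+1$). Formulas are built from atomic formulas with $\bot,\top,\lor,\land,\to,\exists x^n,\forall x^n$. We use intuitionistic logic of partial terms: there is an additional atomic formula $a{\downarrow}$ (`$a$ is defined') for each term $a$; variables are defined; if a term $f(\vec a)$ is defined, or an atomic formula $R(\vec a)$ (including $=$ and $\in$) holds, then all $a_i$ are defined; $\exists$-introduction and $\forall$-elimination with a term $a$, and reflexivity $a=a$, require $a{\downarrow}$. Write $a\simeq b$ for $(a{\downarrow}\lor b{\downarrow})\to a=b$. \textbf{HAHP.} The language of $\mathrm{HAH}$ has function symbols $0$, $\mathsf S$, $+$, $\times$ on sort $0$. The language of $\mathrm{HAHP}$ has in addition a partial binary function symbol $\mathsf{app}$ on sort $0$ (written as juxtaposition, associating to the left) and constants $\mathsf k,\mathsf s,\mathsf{suc},\mathsf{rec}$ of sort $0$. The axioms of $\mathrm{HAHP}$ are: extensionality $\forall X^{n+1}\forall Y^{n+1}(\forall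 z^n(z\in X\leftrightarrow z\in Y)\to X=Y)$; comprehension $\exists X^{n+1}\forall z^n(z\in X\leftrightarrow P[z])$ for every $\mathrm{HAHP}$-formula $P$ (possibly with parameters, not containing $X$); induction $A[0]\land\forall x(A[x]\to A[\mathsf S(x)])\to\forall x\,A[x]$ for every $\mathrm{HAHP}$-formula $A$; $\mathsf S(y)\ne0$, $\mathsf S(x)=\mathsf S(y)\to x=y$, $0+y=y$, $\mathsf S(x)+y=\mathsf S(x+y)$, $0\times y=0$, $\mathsf S(x)\times y=(x\times y)+y$; totality of $0,\mathsf S,+,\times$; and, for all $x,y,z$ of sort $0$, $$\mathsf k\,x\,y=x,\quad \mathsf s\,x\,y{\downarrow},\quad \mathsf s\,x\,y\,z\simeq(x\,z)(y\,z),\quad \mathsf{suc}\,x=\mathsf S(x),\quad \mathsf{rec}\,x\,y\,0=x,\quad \mathsf{rec}\,x\,y\,(\mathsf S z)\simeq y\,z\,(\mathsf{rec}\,x\,y\,z).$$ \textbf{Proposition.} Let $A[x^0,y^0]$ be an $\mathrm{HAH}$-formula with no free variables other than $x,y$ (both of sort $0$). Let $\mathrm{HAHP}R$ be the theory obtained from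 $\mathrm{HAHP}$ by adding to the language a relation symbol $R$ with two arguments of sort $0$, and by adding to the axioms of $\mathrm{HAHP}$ the axioms $$\forall x\,\forall y\,\forall y'\,(R(x,y)\land R(x,y')\to y=y'),\qquad \forall x\,(\exists y\,A[x,y]\to\exists y\,R(x,y)),\qquad \forall x\,\forall y\,(R(x,y)\to A[x,y]),$$ and induction for all formulas of the new language. (Comprehension is not extended: its instances are those of $\mathrm{HAHP}$, for formulas in which $R$ does not occur.) Then $\mathrm{HAHP}R$ is a conservative extension of $\mathrm{HAHP}$: for every $\mathrm{HAHP}$-formula $B$, possibly with free variables, $\mathrm{HAHP}R\vdash B$ if and only if $\mathrm{HAHP}\vdash B$. -/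

import Mathlib

namespace HOArith

/-! ### Monadic higher-order languages

Sorts are natural numbers: sort `0` is the domain of individuals, sort `n + 1` is the power set of
sort `n`. The relations `=` (on each sort) and `∈` (between sorts `n` and `n + 1`) belong to every
language and are built into formulas, so a signature only lists the remaining symbols. -/

/-- A signature: function symbols with their argument sorts and result sort, and relation symbols
with their argument sorts. -/
structure Signature where
  Fn : List ℕ → ℕ → Type
  Rel : List ℕ → Type

/-- An inclusion (interpretation of symbols by symbols) of signatures. -/
structure Signature.Hom (L L' : Signature) where
  onFn : ∀ {l : List ℕ} {n : ℕ}, L.Fn l n → L'.Fn l n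
  onRel : ∀ {l : List ℕ}, L.Rel l → L'.Rel l

/-- `Var Γ n`: the variables of sort `n` in the context `Γ`, a finite list of sorts
(de Bruijn indices; the head of the list is the innermost variable). -/
inductive Var : List ℕ → ℕ → Type
  | zero {Γ : List ℕ} {n : ℕ} : Var (n :: Γ) n
  | succ {Γ : List ℕ} {n m : ℕ} : Var Γ n → Var (m :: Γ) n

/-- Terms of sort `n` whose free variables lie in the context `Γ`. -/
inductive Term (L : Signature) (Γ : List ℕ) : ℕ → Type
  | var {n : ℕ} (x : Var Γ n) : Term L Γ n
  | fn {l : List ℕ} {n : ℕ} (f : L.Fn l n)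
      (args : ∀ i : Fin l.length, Term L Γ (l.get i)) : Term L Γ n

/-- Formulas of the logic of partial terms whose free variables lie in the context `Γ`.
`defd a` is the atomic formula saying that the term `a` is defined. -/
inductive Formula (L : Signature) : List ℕ → Type
  | defd {Γ : List ℕ} {n : ℕ} (a : Term L Γ n) : Formula L Γ
  | eq {Γ : List ℕ} {n : ℕ} (a b : Term L Γ n) : Formula L Γ
  | mem {Γ : List ℕ} {n : ℕ} (a : Term L Γ n) (b : Term L Γ (n + 1)) : Formula L Γ
  | rel {Γ : List ℕ} {l : List ℕ} (R : L.Rel l)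
      (args : ∀ i : Fin l.length, Term L Γ (l.get i)) : Formula L Γ
  | bot {Γ : List ℕ} : Formula L Γ
  | top {Γ : List ℕ} : Formula L Γ
  | or {Γ : List ℕ} (A B : Formula L Γ) : Formula L Γ
  | and {Γ : List ℕ} (A B : Formula L Γ) : Formula L Γ
  | imp {Γ : List ℕ} (A B : Formula L Γ) : Formula L Γ
  | ex {Γ : List ℕ} (n : ℕ) (B : Formula L (n :: Γ)) : Formula L Γ
  | all {Γ : List ℕ} (n : ℕ) (B : Formula L (n :: Γ)) : Formula L Γ

/-! ### Renaming and substitution -/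

/-- Sort-preserving maps of variables. -/
abbrev Ren (Γ Δ : List ℕ) : Type := ∀ n : ℕ, Var Γ n → Var Δ n

/-- Simultaneous substitutions of terms for variables. -/
abbrev Sub (L : Signature) (Γ Δ : List ℕ) : Type := ∀ n : ℕ, Var Γ n → Term L Δ n

/-- Extend a renaming under a binder. -/
def Ren.lift {Γ Δ : List ℕ} (ρ : Ren Γ Δ) (m : ℕ) : Ren (m :: Γ) (m :: Δ)
  | _, .zero => .zero
  | _, .succ x => .succ (ρ _ x)

def Term.rename {L : Signature} {Γ Δ : List ℕ} (ρ : Ren Γ Δ) : {n : ℕ} → Term L Γ n → Term L Δ n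
  | _, .var x => .var (ρ _ x)
  | _, .fn f args => .fn f (fun i => (args i).rename ρ)

def Formula.rename {L : Signature} : {Γ Δ : List ℕ} → Ren Γ Δ → Formula L Γ → Formula L Δ
  | _, _, ρ, .defd a => .defd (a.rename ρ)
  | _, _, ρ, .eq a b => .eq (a.rename ρ) (b.rename ρ)
  | _, _, ρ, .mem a b => .mem (a.rename ρ) (b.rename ρ)
  | _, _, ρ, .rel R args => .rel R (fun i => (args i).rename ρ)
  | _, _, _, .bot => .bot
  | _, _, _, .top => .top
  | _, _, ρ, .or A B => .or (A.rename ρ) (B.rename ρ)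
  | _, _, ρ, .and A B => .and (A.rename ρ) (B.rename ρ)
  | _, _, ρ, .imp A B => .imp (A.rename ρ) (B.rename ρ)
  | _, _, ρ, .ex n B => .ex n (B.rename (ρ.lift n))
  | _, _, ρ, .all n B => .all n (B.rename (ρ.lift n))

/-- Regard a formula over `Γ` as a formula over `Γ` and one more (unused) variable. -/
def Formula.weaken {L : Signature} {Γ : List ℕ} (m : ℕ) (A : Formula L Γ) : Formula L (m :: Γ) :=
  A.rename (fun _ x => .succ x)

/-- Extend a substitution under a binder. -/
def Sub.lift {L : Signature} {Γ Δ : List ℕ} (σ : Sub L Γ Δ) (m : ℕ) : Sub L (m :: Γ) (m :: Δ)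
  | _, .zero => .var .zero
  | _, .succ x => (σ _ x).rename (fun _ y => .succ y)

def Term.subst {L : Signature} {Γ Δ : List ℕ} (σ : Sub L Γ Δ) : {n : ℕ} → Term L Γ n → Term L Δ n
  | _, .var x => σ _ x
  | _, .fn f args => .fn f (fun i => (args i).subst σ)

/-- Capture-avoiding simultaneous substitution. -/
def Formula.subst {L : Signature} : {Γ Δ : List ℕ} → Sub L Γ Δ → Formula L Γ → Formula L Δ
  | _, _, σ, .defd a => .defd (a.subst σ)
  | _, _, σ, .eq a b => .eq (a.subst σ) (b.subst σ)
  | _, _, σ, .mem a b => .mem (a.subst σ) (b.subst σ)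
  | _, _, σ, .rel R args => .rel R (fun i => (args i).subst σ)
  | _, _, _, .bot => .bot
  | _, _, _, .top => .top
  | _, _, σ, .or A B => .or (A.subst σ) (B.subst σ)
  | _, _, σ, .and A B => .and (A.subst σ) (B.subst σ)
  | _, _, σ, .imp A B => .imp (A.subst σ) (B.subst σ)
  | _, _, σ, .ex n B => .ex n (B.subst (σ.lift n))
  | _, _, σ, .all n B => .all n (B.subst (σ.lift n))

/-- The substitution of `a` for the innermost variable. -/
def Sub.single {L : Signature} {Γ : List ℕ} {m : ℕ} (a : Term L Γ m) : Sub L (m :: Γ) Γ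
  | _, .zero => a
  | _, .succ x => .var x

/-- `B[a]` -/
def Formula.inst {L : Signature} {Γ : List ℕ} {m : ℕ} (B : Formula L (m :: Γ)) (a : Term L Γ m) :
    Formula L Γ :=
  B.subst (Sub.single a)

/-! ### Change of language -/

def Term.map {L L' : Signature} (h : L.Hom L') {Γ : List ℕ} : {n : ℕ} → Term L Γ n → Term L' Γ n
  | _, .var x => .var x
  | _, .fn f args => .fn (h.onFn f) (fun i => (args i).map h)

/-- Regard a formula of a language as a formula of a larger language. -/
def Formula.map {L L' : Signature} (h : L.Hom L') : {Γ : List ℕ} → Formula L Γ → Formula L' Γ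
  | _, .defd a => .defd (a.map h)
  | _, .eq a b => .eq (a.map h) (b.map h)
  | _, .mem a b => .mem (a.map h) (b.map h)
  | _, .rel R args => .rel (h.onRel R) (fun i => (args i).map h)
  | _, .bot => .bot
  | _, .top => .top
  | _, .or A B => .or (A.map h) (B.map h)
  | _, .and A B => .and (A.map h) (B.map h)
  | _, .imp A B => .imp (A.map h) (B.map h)
  | _, .ex n B => .ex n (B.map h)
  | _, .all n B => .all n (B.map h)

/-! ### Intuitionistic logic of partial terms -/

/-- A theory is given by its axioms. An axiom over a context `Γ` may have free variables from `Γ`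
(parameters of an axiom scheme); it stands for its universal closure. -/
abbrev Theory (L : Signature) : Type := ∀ Γ : List ℕ, Set (Formula L Γ)

/-- `Provable T Δ A`: natural deduction derivability of `A` from the hypotheses `Δ` in the theory
`T`, in the intuitionistic many-sorted logic of partial terms. Variables range over existing objects
only, so terms that are plugged into a quantifier have to be defined, and reflexivity of equality
holds for defined terms. -/
inductive Provable {L : Signature} (T : Theory L) :
    {Γ : List ℕ} → List (Formula L Γ) → Formula L Γ → Prop
  | ax {Γ : List ℕ} {Δ : List (Formula L Γ)} {A : Formula L Γ} : A ∈ T Γ → Provable T Δ A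
  | hyp {Γ : List ℕ} {Δ : List (Formula L Γ)} {A : Formula L Γ} : A ∈ Δ → Provable T Δ A
  | topI {Γ : List ℕ} {Δ : List (Formula L Γ)} : Provable T Δ .top
  | botE {Γ : List ℕ} {Δ : List (Formula L Γ)} {A : Formula L Γ} :
      Provable T Δ .bot → Provable T Δ A
  | andI {Γ : List ℕ} {Δ : List (Formula L Γ)} {A B : Formula L Γ} :
      Provable T Δ A → Provable T Δ B → Provable T Δ (.and A B)
  | andE₁ {Γ : List ℕ} {Δ : List (Formula L Γ)} {A B : Formula L Γ} :
      Provable T Δ (.and A B) → Provable T Δ A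
  | andE₂ {Γ : List ℕ} {Δ : List (Formula L Γ)} {A B : Formula L Γ} :
      Provable T Δ (.and A B) → Provable T Δ B
  | orI₁ {Γ : List ℕ} {Δ : List (Formula L Γ)} {A B : Formula L Γ} :
      Provable T Δ A → Provable T Δ (.or A B)
  | orI₂ {Γ : List ℕ} {Δ : List (Formula L Γ)} {A B : Formula L Γ} :
      Provable T Δ B → Provable T Δ (.or A B)
  | orE {Γ : List ℕ} {Δ : List (Formula L Γ)} {A B C : Formula L Γ} :
      Provable T Δ (.or A B) → Provable T (A :: Δ) C → Provable T (B :: Δ) C → Provable T Δ C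
  | impI {Γ : List ℕ} {Δ : List (Formula L Γ)} {A B : Formula L Γ} :
      Provable T (A :: Δ) B → Provable T Δ (.imp A B)
  | impE {Γ : List ℕ} {Δ : List (Formula L Γ)} {A B : Formula L Γ} :
      Provable T Δ (.imp A B) → Provable T Δ A → Provable T Δ B
  | allI {Γ : List ℕ} {Δ : List (Formula L Γ)} {n : ℕ} {B : Formula L (n :: Γ)} :
      Provable T (Δ.map (Formula.weaken n)) B → Provable T Δ (.all n B)
  | allE {Γ : List ℕ} {Δ : List (Formula L Γ)} {n : ℕ} {B : Formula L (n :: Γ)} (a : Term L Γ n) :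
      Provable T Δ (.all n B) → Provable T Δ (.defd a) → Provable T Δ (B.inst a)
  | exI {Γ : List ℕ} {Δ : List (Formula L Γ)} {n : ℕ} {B : Formula L (n :: Γ)} (a : Term L Γ n) :
      Provable T Δ (B.inst a) → Provable T Δ (.defd a) → Provable T Δ (.ex n B)
  | exE {Γ : List ℕ} {Δ : List (Formula L Γ)} {n : ℕ} {B : Formula L (n :: Γ)} {C : Formula L Γ} :
      Provable T Δ (.ex n B) → Provable T (B :: Δ.map (Formula.weaken n)) (C.weaken n) →
      Provable T Δ C
  | eqI {Γ : List ℕ} {Δ : List (Formula L Γ)} {n : ℕ} {a : Term L Γ n} :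
      Provable T Δ (.defd a) → Provable T Δ (.eq a a)
  | eqE {Γ : List ℕ} {Δ : List (Formula L Γ)} {n : ℕ} {a b : Term L Γ n}
      (B : Formula L (n :: Γ)) :
      Provable T Δ (.eq a b) → Provable T Δ (B.inst a) → Provable T Δ (B.inst b)
  | defdVar {Γ : List ℕ} {Δ : List (Formula L Γ)} {n : ℕ} (x : Var Γ n) :
      Provable T Δ (.defd (.var x))
  | defdFn {Γ : List ℕ} {Δ : List (Formula L Γ)} {l : List ℕ} {n : ℕ} {f : L.Fn l n}
      {args : ∀ i : Fin l.length, Term L Γ (l.get i)} (i : Fin l.length) :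
      Provable T Δ (.defd (.fn f args)) → Provable T Δ (.defd (args i))
  | defdRel {Γ : List ℕ} {Δ : List (Formula L Γ)} {l : List ℕ} {R : L.Rel l}
      {args : ∀ i : Fin l.length, Term L Γ (l.get i)} (i : Fin l.length) :
      Provable T Δ (.rel R args) → Provable T Δ (.defd (args i))
  | defdEq₁ {Γ : List ℕ} {Δ : List (Formula L Γ)} {n : ℕ} {a b : Term L Γ n} :
      Provable T Δ (.eq a b) → Provable T Δ (.defd a)
  | defdEq₂ {Γ : List ℕ} {Δ : List (Formula L Γ)} {n : ℕ} {a b : Term L Γ n} :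
      Provable T Δ (.eq a b) → Provable T Δ (.defd b)
  | defdMem₁ {Γ : List ℕ} {Δ : List (Formula L Γ)} {n : ℕ} {a : Term L Γ n}
      {b : Term L Γ (n + 1)} : Provable T Δ (.mem a b) → Provable T Δ (.defd a)
  | defdMem₂ {Γ : List ℕ} {Δ : List (Formula L Γ)} {n : ℕ} {a : Term L Γ n}
      {b : Term L Γ (n + 1)} : Provable T Δ (.mem a b) → Provable T Δ (.defd b)

/-- `A` is a theorem of `T`. -/
def Theory.Proves {L : Signature} (T : Theory L) {Γ : List ℕ} (A : Formula L Γ) : Prop :=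
  Provable T [] A

/-- `T'` (over the larger language) is a conservative extension of `T`: it proves exactly the same
formulas in the language of `T`. -/
def Theory.IsConservativeExtension {L L' : Signature} (h : L.Hom L') (T : Theory L)
    (T' : Theory L') : Prop :=
  ∀ (Γ : List ℕ) (B : Formula L Γ), T'.Proves (B.map h) ↔ T.Proves B

/-! ### Abbreviations and axiom schemes -/

/-- Logical equivalence. -/
def Formula.iff {L : Signature} {Γ : List ℕ} (A B : Formula L Γ) : Formula L Γ :=
  .and (.imp A B) (.imp B A)

/-- `a ≃ b`: if one of the terms is defined then they are equal. -/
def Formula.keq {L : Signature} {Γ : List ℕ} {n : ℕ} (a b : Term L Γ n) : Formula L Γ :=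
  .imp (.or (.defd a) (.defd b)) (.eq a b)

/-- Arguments of a constant. -/
def args0 {L : Signature} {Γ : List ℕ} : ∀ i : Fin ([] : List ℕ).length,
    Term L Γ (([] : List ℕ).get i) :=
  fun i => i.elim0

/-- The argument of a unary symbol. -/
def args1 {L : Signature} {Γ : List ℕ} {n : ℕ} (a : Term L Γ n) :
    ∀ i : Fin [n].length, Term L Γ ([n].get i)
  | ⟨0, _⟩ => a

/-- The arguments of a binary symbol. -/
def args2 {L : Signature} {Γ : List ℕ} {n m : ℕ} (a : Term L Γ n) (b : Term L Γ m) :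
    ∀ i : Fin [n, m].length, Term L Γ ([n, m].get i)
  | ⟨0, _⟩ => a
  | ⟨1, _⟩ => b

/-- The innermost variable. -/
def v0 {L : Signature} {Γ : List ℕ} {n : ℕ} : Term L (n :: Γ) n := .var .zero

/-- The second innermost variable. -/
def v1 {L : Signature} {Γ : List ℕ} {n m : ℕ} : Term L (m :: n :: Γ) n := .var (.succ .zero)

/-- The third innermost variable. -/
def v2 {L : Signature} {Γ : List ℕ} {n m k : ℕ} : Term L (k :: m :: n :: Γ) n :=
  .var (.succ (.succ .zero))

/-- `∀ X ∀ Y (∀ z (z ∈ X ↔ z ∈ Y) → X = Y)`, with `X`, `Y` of sort `n + 1` and `z` of sort `n`. -/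
def extensionality (L : Signature) (Γ : List ℕ) (n : ℕ) : Formula L Γ :=
  .all (n + 1) (.all (n + 1)
    (.imp (.all n (.iff (.mem v0 v2) (.mem v0 v1))) (.eq v1 v0)))

/-- `∃ X ∀ z (z ∈ X ↔ P[z])`, where `P` may contain parameters from `Γ`, but not `X`. -/
def comprehension {L : Signature} {Γ : List ℕ} {n : ℕ} (P : Formula L (n :: Γ)) : Formula L Γ :=
  .ex (n + 1) (.all n
    (.iff (.mem v0 v1) (P.rename (Ren.lift (fun _ x => .succ x) n))))

/-! ### The language and the basic axioms of arithmetic -/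

/-- Zero, successor, addition, multiplication. -/
inductive HAHFn : List ℕ → ℕ → Type
  | zero : HAHFn [] 0
  | succ : HAHFn [0] 0
  | add : HAHFn [0, 0] 0
  | mul : HAHFn [0, 0] 0

/-- The language of HAH. -/
def HAHLang : Signature where
  Fn := HAHFn
  Rel := fun _ => Empty

def zero {L : Signature} (h : HAHLang.Hom L) {Γ : List ℕ} : Term L Γ 0 :=
  .fn (h.onFn HAHFn.zero) args0

def succ {L : Signature} (h : HAHLang.Hom L) {Γ : List ℕ} (a : Term L Γ 0) : Term L Γ 0 :=
  .fn (h.onFn HAHFn.succ) (args1 a)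

def add {L : Signature} (h : HAHLang.Hom L) {Γ : List ℕ} (a b : Term L Γ 0) : Term L Γ 0 :=
  .fn (h.onFn HAHFn.add) (args2 a b)

def mul {L : Signature} (h : HAHLang.Hom L) {Γ : List ℕ} (a b : Term L Γ 0) : Term L Γ 0 :=
  .fn (h.onFn HAHFn.mul) (args2 a b)

/-- The substitution of `S(x)` for the innermost variable `x` (of sort `0`). -/
def Sub.succ {L : Signature} (h : HAHLang.Hom L) {Γ : List ℕ} : Sub L (0 :: Γ) (0 :: Γ)
  | _, .zero => HOArith.succ h (.var .zero)
  | _, .succ x => .var (.succ x)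

/-- `A[0] ∧ ∀ x (A[x] → A[S(x)]) → ∀ x A[x]` -/
def induction {L : Signature} (h : HAHLang.Hom L) {Γ : List ℕ} (A : Formula L (0 :: Γ)) :
    Formula L Γ :=
  .imp (.and (A.inst (zero h)) (.all 0 (.imp A (A.subst (Sub.succ h))))) (.all 0 A)

/-- The axioms of arithmetic apart from induction; the last four say that the function symbols
are total. -/
inductive ArithAxiom {L : Signature} (h : HAHLang.Hom L) (Γ : List ℕ) : Formula L Γ → Prop
  | succ_ne_zero : ArithAxiom h Γ (.all 0 (.imp (.eq (succ h v0) (zero h)) .bot))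
  | succ_inj : ArithAxiom h Γ
      (.all 0 (.all 0 (.imp (.eq (succ h v1) (succ h v0)) (.eq v1 v0))))
  | zero_add : ArithAxiom h Γ (.all 0 (.eq (add h (zero h) v0) v0))
  | succ_add : ArithAxiom h Γ
      (.all 0 (.all 0 (.eq (add h (succ h v1) v0) (succ h (add h v1 v0)))))
  | zero_mul : ArithAxiom h Γ (.all 0 (.eq (mul h (zero h) v0) (zero h)))
  | succ_mul : ArithAxiom h Γ
      (.all 0 (.all 0 (.eq (mul h (succ h v1) v0) (add h (mul h v1 v0) v0))))
  | zero_defd : ArithAxiom h Γ (.defd (zero h))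
  | succ_defd : ArithAxiom h Γ (.all 0 (.defd (succ h v0)))
  | add_defd : ArithAxiom h Γ (.all 0 (.all 0 (.defd (add h v1 v0))))
  | mul_defd : ArithAxiom h Γ (.all 0 (.all 0 (.defd (mul h v1 v0))))

/-! ### HAHP -/

/-- The function symbols of HAH, a binary (partial) application, and four constants. -/
inductive HAHPFn : List ℕ → ℕ → Type
  | ofHAH {l : List ℕ} {n : ℕ} (f : HAHFn l n) : HAHPFn l n
  | app : HAHPFn [0, 0] 0
  | kC : HAHPFn [] 0
  | sC : HAHPFn [] 0
  | sucC : HAHPFn [] 0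
  | recC : HAHPFn [] 0

/-- The language of HAHP. -/
def HAHPLang : Signature where
  Fn := HAHPFn
  Rel := fun _ => Empty

/-- The language of HAH is part of the language of HAHP. -/
def HAHLang.toHAHP : HAHLang.Hom HAHPLang where
  onFn := HAHPFn.ofHAH
  onRel := fun R => R

def app {Γ : List ℕ} (a b : Term HAHPLang Γ 0) : Term HAHPLang Γ 0 :=
  .fn (L := HAHPLang) HAHPFn.app (args2 a b)

def kC {Γ : List ℕ} : Term HAHPLang Γ 0 := .fn (L := HAHPLang) HAHPFn.kC args0

def sC {Γ : List ℕ} : Term HAHPLang Γ 0 := .fn (L := HAHPLang) HAHPFn.sC args0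

def sucC {Γ : List ℕ} : Term HAHPLang Γ 0 := .fn (L := HAHPLang) HAHPFn.sucC args0

def recC {Γ : List ℕ} : Term HAHPLang Γ 0 := .fn (L := HAHPLang) HAHPFn.recC args0

/-- The axioms of HAHP; the schemes range over all formulas of the language of HAHP. -/
inductive HAHPAxiom (Γ : List ℕ) : Formula HAHPLang Γ → Prop
  | ext (n : ℕ) : HAHPAxiom Γ (extensionality HAHPLang Γ n)
  | comp {n : ℕ} (P : Formula HAHPLang (n :: Γ)) : HAHPAxiom Γ (comprehension P)
  | arith {A : Formula HAHPLang Γ} : ArithAxiom HAHLang.toHAHP Γ A → HAHPAxiom Γ A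
  | ind (A : Formula HAHPLang (0 :: Γ)) : HAHPAxiom Γ (induction HAHLang.toHAHP A)
  | k_eq : HAHPAxiom Γ (.all 0 (.all 0 (.eq (app (app kC v1) v0) v1)))
  | s_defd : HAHPAxiom Γ (.all 0 (.all 0 (.defd (app (app sC v1) v0))))
  | s_eq : HAHPAxiom Γ (.all 0 (.all 0 (.all 0
      (.keq (app (app (app sC v2) v1) v0) (app (app v2 v0) (app v1 v0))))))
  | suc_eq : HAHPAxiom Γ (.all 0 (.eq (app sucC v0) (succ HAHLang.toHAHP v0)))
  | rec_zero : HAHPAxiom Γ (.all 0 (.all 0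
      (.eq (app (app (app recC v1) v0) (zero HAHLang.toHAHP)) v1)))
  | rec_succ : HAHPAxiom Γ (.all 0 (.all 0 (.all 0
      (.keq (app (app (app recC v2) v1) (succ HAHLang.toHAHP v0))
        (app (app v1 v0) (app (app (app recC v2) v1) v0))))))

/-- Higher-order Heyting arithmetic with primitive application. -/
def HAHP : Theory HAHPLang := fun Γ => {A | HAHPAxiom Γ A}

/-! ### Adding a relation symbol -/

/-- The new relation symbol. -/
inductive RSymbol : List ℕ → Type
  | R : RSymbol [0, 0]

/-- The language of HAHP with a binary relation symbol `R` on sort `0`. -/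
def HAHPRLang : Signature where
  Fn := HAHPFn
  Rel := RSymbol

/-- The language of HAHP is part of the language with `R`. -/
def HAHPLang.toHAHPR : HAHPLang.Hom HAHPRLang where
  onFn := fun f => f
  onRel := fun R => nomatch R

/-- The language of HAH is part of the language with `R`. -/
def HAHLang.toHAHPR : HAHLang.Hom HAHPRLang where
  onFn := HAHPFn.ofHAH
  onRel := fun R => nomatch R

/-- The atomic formula `R(a, b)`. -/
def relR {Γ : List ℕ} (a b : Term HAHPRLang Γ 0) : Formula HAHPRLang Γ :=
  .rel (L := HAHPRLang) RSymbol.R (args2 a b)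

/-- The inclusion of the context consisting of `x` and `y` (`y` innermost) in a context that has
further variables. -/
def Ren.two {Γ : List ℕ} : Ren [0, 0] (0 :: 0 :: Γ)
  | _, .zero => .zero
  | _, .succ .zero => .succ .zero

/-- `A[x, y]` as a formula of the language with `R`, in any context in which `y` and `x` are the
innermost and second innermost variables. -/
def liftA {Γ : List ℕ} (A : Formula HAHLang [0, 0]) : Formula HAHPRLang (0 :: 0 :: Γ) :=
  (A.map HAHLang.toHAHPR).rename Ren.two

/-- The axioms of HAHPR for the formula `A[x, y]` (where `y` is the innermost variable): those of
HAHP, induction for all formulas of the new language, and three axioms for `R`. -/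
inductive HAHPRAxiom (A : Formula HAHLang [0, 0]) (Γ : List ℕ) : Formula HAHPRLang Γ → Prop
  | hahp {B : Formula HAHPLang Γ} : HAHPAxiom Γ B → HAHPRAxiom A Γ (B.map HAHPLang.toHAHPR)
  | ind (B : Formula HAHPRLang (0 :: Γ)) : HAHPRAxiom A Γ (induction HAHLang.toHAHPR B)
  | functional : HAHPRAxiom A Γ (.all 0 (.all 0 (.all 0
      (.imp (.and (relR v2 v1) (relR v2 v0)) (.eq v1 v0)))))
  | inhabited : HAHPRAxiom A Γ (.all 0 (.imp (.ex 0 (liftA A)) (.ex 0 (relR v1 v0))))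
  | sound : HAHPRAxiom A Γ (.all 0 (.all 0 (.imp (relR v1 v0) (liftA A))))

/-- The extension of HAHP with the relation symbol `R` and its axioms for the formula `A`. -/
def HAHPR (A : Formula HAHLang [0, 0]) : Theory HAHPRLang := fun Γ => {B | HAHPRAxiom A Γ B}

end HOArith

/-! The proof is a forcing argument carried out inside HAHP. A condition is a number `e` of sort `0`
such that `app e z` is defined for every `z` and is either `0` or some `S b` with `A[z, b]`. It
codes a partial choice function for `A`, with `0` meaning "undefined at `z`". One condition is below
another if it keeps all positive values of the other. Being a condition and being below are formulas
of HAHP, so each formula `B` of the language with `R` has a translation "`p` forces `B`" into HAHP.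

In this translation `R(a, b)` is forced by `p` if densely many `q` below `p` satisfy `q a = S b`.
The other atomic formulas keep their meaning. Disjunction and existence are read densely below `p`,
implication at all conditions below `p`, conjunction and universal quantification pointwise.
Quantifiers of every sort range over the original objects: no names for new sets are introduced.

Four facts carry the argument. (1) Forcing is monotone and local (`force_mono`, `force_local`),
which makes the rules of intuitionistic logic sound (`force_of_provable`). (2) A formula without `R`
is forced exactly when it holds (`force_map_iff`). Hence all axioms of HAHP are forced, including
comprehension, which is required only for formulas without `R`. Induction for formulas with `R` is
induction in HAHP for the translated formula (`force_induction`). (3) Values of conditions satisfy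
`A`, and extensions preserve them, so `R` is forced to be functional and to be contained in `A`. (4)
If `A[x, y]` holds, every condition can be extended to one defined at `x` (`exBelow_defined`).
Totality of the coding function makes it decidable whether a condition is already defined at `x`; if
it is not, its value at `x` is changed to `S y`. The changed function is obtained from the recursor
and the combinators by induction on `x` (`updatable_of_defd`).

If HAHP with `R` proves `B`, where `B` has no `R`, then the everywhere undefined condition `k 0`
forces `B`, so HAHP proves `B`. -/

namespace HOArith

/-! ### Substitution calculus -/

section Substitution

variable {L L' L'' : Signature}

theorem args0_eq {Γ : List ℕ} (f : ∀ i : Fin ([] : List ℕ).length, Term L Γ (([] : List ℕ).get i)) :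
    f = args0 := funext fun i => i.elim0

theorem args1_eq {Γ : List ℕ} {n : ℕ} (f : ∀ i : Fin [n].length, Term L Γ ([n].get i)) :
    f = args1 (f ⟨0, Nat.zero_lt_one⟩) := by
  funext i
  match i with
  | ⟨0, _⟩ => rfl

theorem args2_eq {Γ : List ℕ} {n m : ℕ}
    (f : ∀ i : Fin [n, m].length, Term L Γ ([n, m].get i)) :
    f = args2 (f ⟨0, Nat.zero_lt_two⟩) (f ⟨1, Nat.one_lt_two⟩) := by
  funext i
  match i with
  | ⟨0, _⟩ => rfl
  | ⟨1, _⟩ => rfl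

/-- The identity substitution. -/
def Sub.id {Γ : List ℕ} : Sub L Γ Γ := fun _ x => .var x

/-- A substitution followed by a substitution. -/
def Sub.comp {Γ Δ E : List ℕ} (σ : Sub L Γ Δ) (τ : Sub L Δ E) : Sub L Γ E :=
  fun n x => (σ n x).subst τ

/-- A renaming as a substitution. -/
def Ren.toSub {Γ Δ : List ℕ} (ρ : Ren Γ Δ) : Sub L Γ Δ := fun n x => .var (ρ n x)

/-- The substitution that adds an unused innermost variable. -/
def Sub.shift {Γ : List ℕ} (m : ℕ) : Sub L Γ (m :: Γ) := fun _ x => .var (.succ x)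

/-- Extend a substitution by a term for a new innermost variable. -/
def Sub.cons {Γ Δ : List ℕ} {m : ℕ} (a : Term L Δ m) (σ : Sub L Γ Δ) : Sub L (m :: Γ) Δ
  | _, .zero => a
  | _, .succ x => σ _ x

theorem Sub.single_eq {Γ : List ℕ} {m : ℕ} (a : Term L Γ m) :
    Sub.single a = Sub.cons a Sub.id := by
  funext n x; cases x <;> rfl

theorem Term.rename_eq_subst {Γ Δ : List ℕ} (ρ : Ren Γ Δ) {n : ℕ} (t : Term L Γ n) :
    t.rename ρ = t.subst ρ.toSub := by
  induction t with
  | var x => rfl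
  | fn f args ih => simp only [Term.rename, Term.subst, ih]

theorem Ren.lift_toSub {Γ Δ : List ℕ} (ρ : Ren Γ Δ) (m : ℕ) :
    ((ρ.lift m).toSub : Sub L _ _) = Sub.lift ρ.toSub m := by
  funext n x; cases x <;> rfl

theorem Formula.rename_eq_subst {Γ Δ : List ℕ} (ρ : Ren Γ Δ) (A : Formula L Γ) :
    A.rename ρ = A.subst ρ.toSub := by
  induction A generalizing Δ <;>
    simp_all only [Formula.rename, Formula.subst, Term.rename_eq_subst, Ren.lift_toSub]

theorem Term.subst_subst {Γ Δ E : List ℕ} (σ : Sub L Γ Δ) (τ : Sub L Δ E) {n : ℕ}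
    (t : Term L Γ n) : (t.subst σ).subst τ = t.subst (σ.comp τ) := by
  induction t with
  | var x => rfl
  | fn f args ih => simp only [Term.subst, ih]

theorem Term.subst_rename {Γ Δ E : List ℕ} (σ : Sub L Γ Δ) (ρ : Ren Δ E) {n : ℕ}
    (t : Term L Γ n) : (t.subst σ).rename ρ = t.subst (σ.comp ρ.toSub) := by
  rw [Term.rename_eq_subst, Term.subst_subst]

theorem Term.rename_subst {Γ Δ E : List ℕ} (ρ : Ren Γ Δ) (σ : Sub L Δ E) {n : ℕ}
    (t : Term L Γ n) : (t.rename ρ).subst σ = t.subst (fun n x => σ n (ρ n x)) := by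
  rw [Term.rename_eq_subst, Term.subst_subst]; rfl

/-- Lifting renames the substituted terms, so functoriality of lifting needs the two laws that
exchange a substitution with a renaming. With it, the composition law passes from terms to formulas
under binders. -/
theorem Sub.lift_comp_lift {Γ Δ E : List ℕ} (σ : Sub L Γ Δ) (τ : Sub L Δ E) (m : ℕ) :
    (σ.lift m).comp (τ.lift m) = (σ.comp τ).lift m := by
  funext n x
  cases x with
  | zero => rfl
  | succ x =>
    show ((σ _ x).rename _).subst _ = ((σ _ x).subst τ).rename _
    rw [Term.rename_subst, Term.subst_rename]
    congr 1
    funext k y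
    show (τ _ y).rename _ = (τ _ y).subst _
    rw [Term.rename_eq_subst]

theorem Formula.subst_subst {Γ Δ E : List ℕ} (σ : Sub L Γ Δ) (τ : Sub L Δ E)
    (A : Formula L Γ) : (A.subst σ).subst τ = A.subst (σ.comp τ) := by
  induction A generalizing Δ E <;>
    simp_all only [Formula.subst, Term.subst_subst, Sub.lift_comp_lift]

theorem Term.subst_id {Γ : List ℕ} {n : ℕ} (t : Term L Γ n) : t.subst Sub.id = t := by
  induction t with
  | var x => rfl
  | fn f args ih => simp only [Term.subst, ih]

theorem Sub.lift_id {Γ : List ℕ} (m : ℕ) : (Sub.id : Sub L Γ Γ).lift m = Sub.id := by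
  funext n x; cases x <;> rfl

theorem Formula.subst_id {Γ : List ℕ} (A : Formula L Γ) : A.subst Sub.id = A := by
  induction A <;> simp_all only [Formula.subst, Term.subst_id, Sub.lift_id]

theorem Sub.id_comp {Γ Δ : List ℕ} (σ : Sub L Γ Δ) : Sub.id.comp σ = σ := rfl

theorem Sub.comp_id {Γ Δ : List ℕ} (σ : Sub L Γ Δ) : σ.comp Sub.id = σ := by
  funext n x; exact Term.subst_id _

theorem Sub.comp_assoc {Γ Δ E F : List ℕ} (σ : Sub L Γ Δ) (τ : Sub L Δ E) (υ : Sub L E F) :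
    (σ.comp τ).comp υ = σ.comp (τ.comp υ) := by
  funext n x; exact Term.subst_subst _ _ _

theorem Sub.cons_comp {Γ Δ E : List ℕ} {m : ℕ} (a : Term L Δ m) (σ : Sub L Γ Δ)
    (τ : Sub L Δ E) : (Sub.cons a σ).comp τ = Sub.cons (a.subst τ) (σ.comp τ) := by
  funext n x; cases x <;> rfl

theorem Sub.lift_eq {Γ Δ : List ℕ} (σ : Sub L Γ Δ) (m : ℕ) :
    σ.lift m = Sub.cons (.var .zero) (σ.comp (Sub.shift m)) := by
  funext n x
  cases x with
  | zero => rfl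
  | succ x => exact Term.rename_eq_subst _ _

theorem Sub.succ_eq (h : HAHLang.Hom L) {Γ : List ℕ} :
    (Sub.succ h : Sub L (0 :: Γ) _) = Sub.cons (HOArith.succ h v0) (Sub.shift 0) := by
  funext n x; cases x <;> rfl

theorem Sub.shift_comp_cons {Γ Δ : List ℕ} {m : ℕ} (a : Term L Δ m) (σ : Sub L Γ Δ) :
    (Sub.shift m).comp (Sub.cons a σ) = σ := rfl

theorem Sub.lift_comp_cons {Γ Δ E : List ℕ} {m : ℕ} (a : Term L E m) (σ : Sub L Γ Δ)
    (τ : Sub L Δ E) : (σ.lift m).comp (Sub.cons a τ) = Sub.cons a (σ.comp τ) := by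
  rw [Sub.lift_eq, Sub.cons_comp, Sub.comp_assoc, Sub.shift_comp_cons]; rfl

theorem Formula.weaken_eq_subst {Γ : List ℕ} (m : ℕ) (A : Formula L Γ) :
    A.weaken m = A.subst (Sub.shift m) :=
  Formula.rename_eq_subst _ _

theorem Formula.inst_eq_subst {Γ : List ℕ} {m : ℕ} (B : Formula L (m :: Γ)) (a : Term L Γ m) :
    B.inst a = B.subst (Sub.cons a Sub.id) := by
  rw [Formula.inst, Sub.single_eq]

theorem Formula.inst_subst {Γ Δ : List ℕ} {m : ℕ} (B : Formula L (m :: Γ)) (a : Term L Γ m)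
    (σ : Sub L Γ Δ) : (B.inst a).subst σ = (B.subst (σ.lift m)).inst (a.subst σ) := by
  simp only [Formula.inst_eq_subst, Formula.subst_subst, Sub.cons_comp, Sub.lift_comp_cons,
    Sub.id_comp, Sub.comp_id]

theorem Formula.weaken_subst_lift {Γ Δ : List ℕ} (m : ℕ) (A : Formula L Γ)
    (σ : Sub L Γ Δ) : (A.weaken m).subst (σ.lift m) = (A.subst σ).weaken m := by
  simp only [Formula.weaken_eq_subst, Formula.subst_subst, Sub.lift_eq, Sub.shift_comp_cons]

/-! ### Change of language and substitution -/

/-- The image of a substitution in a larger language. -/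
def Sub.map (h : L.Hom L') {Γ Δ : List ℕ} (σ : Sub L Γ Δ) : Sub L' Γ Δ :=
  fun n x => (σ n x).map h

theorem Term.map_subst (h : L.Hom L') {Γ Δ : List ℕ} (σ : Sub L Γ Δ) {n : ℕ}
    (t : Term L Γ n) : (t.subst σ).map h = (t.map h).subst (σ.map h) := by
  induction t with
  | var x => rfl
  | fn f args ih => simp only [Term.subst, Term.map, ih]

theorem Sub.map_toSub (h : L.Hom L') {Γ Δ : List ℕ} (ρ : Ren Γ Δ) :
    Sub.map h ρ.toSub = ρ.toSub := rfl

theorem Sub.map_cons (h : L.Hom L') {Γ Δ : List ℕ} {m : ℕ} (a : Term L Δ m) (σ : Sub L Γ Δ) :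
    Sub.map h (Sub.cons a σ) = Sub.cons (a.map h) (σ.map h) := by
  funext n x; cases x <;> rfl

theorem Sub.map_id (h : L.Hom L') {Γ : List ℕ} :
    Sub.map h (Sub.id : Sub L Γ Γ) = Sub.id := rfl

theorem Sub.map_lift (h : L.Hom L') {Γ Δ : List ℕ} (σ : Sub L Γ Δ) (m : ℕ) :
    (σ.lift m).map h = (σ.map h).lift m := by
  funext n x
  cases x with
  | zero => rfl
  | succ x =>
    show ((σ _ x).rename _).map h = ((σ _ x).map h).rename _
    rw [Term.rename_eq_subst, Term.rename_eq_subst, Term.map_subst]; rfl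

theorem Formula.map_subst (h : L.Hom L') {Γ Δ : List ℕ} (σ : Sub L Γ Δ) (A : Formula L Γ) :
    (A.subst σ).map h = (A.map h).subst (σ.map h) := by
  induction A generalizing Δ <;>
    simp_all only [Formula.subst, Formula.map, Term.map_subst, Sub.map_lift]

theorem Formula.map_rename (h : L.Hom L') {Γ Δ : List ℕ} (ρ : Ren Γ Δ) (A : Formula L Γ) :
    (A.rename ρ).map h = (A.map h).rename ρ := by
  simp only [Formula.rename_eq_subst, Formula.map_subst, Sub.map_toSub]

theorem Formula.map_weaken (h : L.Hom L') {Γ : List ℕ} (m : ℕ) (A : Formula L Γ) :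
    (A.weaken m).map h = (A.map h).weaken m := Formula.map_rename _ _ _

theorem Formula.map_inst (h : L.Hom L') {Γ : List ℕ} {m : ℕ} (B : Formula L (m :: Γ))
    (a : Term L Γ m) : (B.inst a).map h = (B.map h).inst (a.map h) := by
  simp only [Formula.inst_eq_subst, Formula.map_subst, Sub.map_cons, Sub.map_id]

end Substitution

/-! ### Structural properties of derivations -/

section Derivations

variable {L L' : Signature}

theorem Provable.mono {T : Theory L} {Γ : List ℕ} {Δ Δ' : List (Formula L Γ)}
    {A : Formula L Γ} (d : Provable T Δ A) (hs : Δ ⊆ Δ') : Provable T Δ' A := by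
  induction d with
  | ax h => exact .ax h
  | hyp h => exact .hyp (hs h)
  | topI => exact .topI
  | botE _ ih => exact .botE (ih hs)
  | andI _ _ ih₁ ih₂ => exact .andI (ih₁ hs) (ih₂ hs)
  | andE₁ _ ih => exact .andE₁ (ih hs)
  | andE₂ _ ih => exact .andE₂ (ih hs)
  | orI₁ _ ih => exact .orI₁ (ih hs)
  | orI₂ _ ih => exact .orI₂ (ih hs)
  | orE _ _ _ ih ih₁ ih₂ =>
    exact .orE (ih hs) (ih₁ (List.cons_subset_cons _ hs)) (ih₂ (List.cons_subset_cons _ hs))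
  | impI _ ih => exact .impI (ih (List.cons_subset_cons _ hs))
  | impE _ _ ih₁ ih₂ => exact .impE (ih₁ hs) (ih₂ hs)
  | allI _ ih => exact .allI (ih (List.map_subset _ hs))
  | allE a _ _ ih₁ ih₂ => exact .allE a (ih₁ hs) (ih₂ hs)
  | exI a _ _ ih₁ ih₂ => exact .exI a (ih₁ hs) (ih₂ hs)
  | exE _ _ ih₁ ih₂ =>
    exact .exE (ih₁ hs) (ih₂ (List.cons_subset_cons _ (List.map_subset _ hs)))
  | eqI _ ih => exact .eqI (ih hs)
  | eqE B _ _ ih₁ ih₂ => exact .eqE B (ih₁ hs) (ih₂ hs)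
  | defdVar x => exact .defdVar x
  | defdFn i _ ih => exact .defdFn i (ih hs)
  | defdRel i _ ih => exact .defdRel i (ih hs)
  | defdEq₁ _ ih => exact .defdEq₁ (ih hs)
  | defdEq₂ _ ih => exact .defdEq₂ (ih hs)
  | defdMem₁ _ ih => exact .defdMem₁ (ih hs)
  | defdMem₂ _ ih => exact .defdMem₂ (ih hs)

theorem Provable.cons {T : Theory L} {Γ : List ℕ} {Δ : List (Formula L Γ)}
    {A B : Formula L Γ} (d : Provable T Δ A) : Provable T (B :: Δ) A :=
  d.mono (List.subset_cons_self _ _)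

/-- A theory closed under renaming of the parameters of its axioms. -/
def Theory.RenameClosed (T : Theory L) : Prop :=
  ∀ {Γ Δ : List ℕ} (ρ : Ren Γ Δ) (A : Formula L Γ), A ∈ T Γ → A.rename ρ ∈ T Δ

theorem Formula.inst_rename {Γ Δ : List ℕ} {m : ℕ} (B : Formula L (m :: Γ)) (a : Term L Γ m)
    (ρ : Ren Γ Δ) : (B.inst a).rename ρ = (B.rename (ρ.lift m)).inst (a.rename ρ) := by
  simp only [Formula.rename_eq_subst, Formula.inst_subst, Ren.lift_toSub, Term.rename_eq_subst]

theorem Formula.weaken_rename_lift {Γ Δ : List ℕ} (m : ℕ) (A : Formula L Γ) (ρ : Ren Γ Δ) :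
    (A.weaken m).rename (ρ.lift m) = (A.rename ρ).weaken m := by
  simp only [Formula.rename_eq_subst, Ren.lift_toSub, Formula.weaken_subst_lift]

theorem Formula.map_weaken_rename_lift {Γ Δ : List ℕ} (m : ℕ) (Θ : List (Formula L Γ))
    (ρ : Ren Γ Δ) : (Θ.map (Formula.weaken m)).map (Formula.rename (ρ.lift m)) =
      (Θ.map (Formula.rename ρ)).map (Formula.weaken m) := by
  simp [Formula.weaken_rename_lift]

/-- Only renamings are admitted: a general substitution could replace a variable by an undefined
term and would break the rule `defdVar`. Renamings suffice for adding fresh variables to a context.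
-/
theorem Provable.rename {T : Theory L} (hT : T.RenameClosed) {Γ : List ℕ}
    {Θ : List (Formula L Γ)} {A : Formula L Γ} (d : Provable T Θ A) {Δ : List ℕ} (ρ : Ren Γ Δ) :
    Provable T (Θ.map (Formula.rename ρ)) (A.rename ρ) := by
  induction d generalizing Δ with
  | ax h => exact .ax (hT ρ _ h)
  | hyp h => exact .hyp (List.mem_map_of_mem h)
  | topI => exact .topI
  | botE _ ih => exact .botE (ih ρ)
  | andI _ _ ih₁ ih₂ => exact .andI (ih₁ ρ) (ih₂ ρ)
  | andE₁ _ ih => exact .andE₁ (ih ρ)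
  | andE₂ _ ih => exact .andE₂ (ih ρ)
  | orI₁ _ ih => exact .orI₁ (ih ρ)
  | orI₂ _ ih => exact .orI₂ (ih ρ)
  | orE _ _ _ ih ih₁ ih₂ => exact .orE (ih ρ) (ih₁ ρ) (ih₂ ρ)
  | impI _ ih => exact .impI (ih ρ)
  | impE _ _ ih₁ ih₂ => exact .impE (ih₁ ρ) (ih₂ ρ)
  | allI _ ih =>
    refine .allI ?_
    have := ih (ρ.lift _)
    rwa [Formula.map_weaken_rename_lift] at this
  | allE a _ _ ih₁ ih₂ =>
    rw [Formula.inst_rename]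
    exact .allE _ (ih₁ ρ) (ih₂ ρ)
  | exI a _ _ ih₁ ih₂ =>
    have := ih₁ ρ
    rw [Formula.inst_rename] at this
    exact .exI _ this (ih₂ ρ)
  | exE _ _ ih₁ ih₂ =>
    refine .exE (ih₁ ρ) ?_
    have := ih₂ (ρ.lift _)
    rwa [List.map_cons, Formula.map_weaken_rename_lift, Formula.weaken_rename_lift] at this
  | eqI _ ih => exact .eqI (ih ρ)
  | eqE B _ _ ih₁ ih₂ =>
    have := ih₂ ρ
    rw [Formula.inst_rename] at this ⊢
    exact .eqE _ (ih₁ ρ) this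
  | defdVar x => exact .defdVar _
  | defdFn i _ ih => exact .defdFn (args := fun i => (Term.rename ρ _)) i (ih ρ)
  | defdRel i _ ih => exact .defdRel (args := fun i => (Term.rename ρ _)) i (ih ρ)
  | defdEq₁ _ ih => exact .defdEq₁ (ih ρ)
  | defdEq₂ _ ih => exact .defdEq₂ (ih ρ)
  | defdMem₁ _ ih => exact .defdMem₁ (ih ρ)
  | defdMem₂ _ ih => exact .defdMem₂ (ih ρ)

theorem Formula.map_map_weaken (h : L.Hom L') {Γ : List ℕ} (m : ℕ) (Θ : List (Formula L Γ)) :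
    (Θ.map (Formula.weaken m)).map (Formula.map h) =
      (Θ.map (Formula.map h)).map (Formula.weaken m) := by
  simp [Formula.map_weaken]

/-- With the inclusion of languages this gives the easy direction of conservativity. -/
theorem Provable.map {T : Theory L} {T' : Theory L'} (h : L.Hom L')
    (hT : ∀ (Γ : List ℕ) (A : Formula L Γ), A ∈ T Γ → A.map h ∈ T' Γ) {Γ : List ℕ}
    {Θ : List (Formula L Γ)} {A : Formula L Γ} (d : Provable T Θ A) :
    Provable T' (Θ.map (Formula.map h)) (A.map h) := by
  induction d with
  | ax h => exact .ax (hT _ _ h)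
  | hyp h => exact .hyp (List.mem_map_of_mem h)
  | topI => exact .topI
  | botE _ ih => exact .botE ih
  | andI _ _ ih₁ ih₂ => exact .andI ih₁ ih₂
  | andE₁ _ ih => exact .andE₁ ih
  | andE₂ _ ih => exact .andE₂ ih
  | orI₁ _ ih => exact .orI₁ ih
  | orI₂ _ ih => exact .orI₂ ih
  | orE _ _ _ ih ih₁ ih₂ => exact .orE ih ih₁ ih₂
  | impI _ ih => exact .impI ih
  | impE _ _ ih₁ ih₂ => exact .impE ih₁ ih₂
  | allI _ ih =>
    rw [Formula.map_map_weaken] at ih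
    exact .allI ih
  | allE a _ _ ih₁ ih₂ =>
    rw [Formula.map_inst]
    exact .allE _ ih₁ ih₂
  | exI a _ _ ih₁ ih₂ =>
    rw [Formula.map_inst] at ih₁
    exact .exI _ ih₁ ih₂
  | exE _ _ ih₁ ih₂ =>
    rw [List.map_cons, Formula.map_map_weaken, Formula.map_weaken] at ih₂
    exact .exE ih₁ ih₂
  | eqI _ ih => exact .eqI ih
  | eqE B _ _ ih₁ ih₂ =>
    rw [Formula.map_inst] at ih₂ ⊢
    exact .eqE _ ih₁ ih₂
  | defdVar x => exact .defdVar _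
  | defdFn i _ ih => exact .defdFn (args := fun i => (Term.map h _)) i ih
  | defdRel i _ ih => exact .defdRel (args := fun i => (Term.map h _)) i ih
  | defdEq₁ _ ih => exact .defdEq₁ ih
  | defdEq₂ _ ih => exact .defdEq₂ ih
  | defdMem₁ _ ih => exact .defdMem₁ ih
  | defdMem₂ _ ih => exact .defdMem₂ ih

end Derivations

/-! ### Simplification of substitutions -/

section Simplification

variable {L : Signature}

-- Oriented in this way, the equations rewrite iterated substitutions to a single one, built from
-- extensions by a term and from shifts, with compositions associated to the right. Formulas that
-- differ only in bookkeeping of variables are then identified by simplification.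
attribute [simp] Formula.subst Formula.inst_eq_subst Formula.weaken_eq_subst Formula.subst_subst
  Formula.subst_id Formula.rename_eq_subst Term.subst_subst Term.subst_id Term.rename_eq_subst
  Sub.lift_eq Sub.cons_comp Sub.comp_assoc Sub.id_comp Sub.comp_id Sub.shift_comp_cons
  Ren.lift_toSub v0 v1 v2

@[simp]
theorem Term.var_zero_subst_cons {Γ Δ : List ℕ} {m : ℕ} (a : Term L Δ m) (σ : Sub L Γ Δ) :
    (Term.var Var.zero : Term L (m :: Γ) m).subst (Sub.cons a σ) = a := rfl

@[simp]
theorem Term.var_succ_subst_cons {Γ Δ : List ℕ} {m n : ℕ} (a : Term L Δ m) (σ : Sub L Γ Δ)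
    (x : Var Γ n) :
    (Term.var (Var.succ x) : Term L (m :: Γ) n).subst (Sub.cons a σ) = (Term.var x).subst σ := rfl

@[simp]
theorem Term.var_subst_shift {Γ : List ℕ} {m n : ℕ} (x : Var Γ n) :
    (Term.var x : Term L Γ n).subst (Sub.shift m) = Term.var (Var.succ x) := rfl

@[simp]
theorem Term.var_subst_shift_comp {Γ Δ : List ℕ} {m n : ℕ} (x : Var Γ n)
    (σ : Sub L (m :: Γ) Δ) :
    (Term.var x : Term L Γ n).subst ((Sub.shift m).comp σ) =
      (Term.var (Var.succ x)).subst σ := rfl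

@[simp]
theorem Ren.succ_toSub {Γ : List ℕ} {m : ℕ} :
    (Ren.toSub (fun _ x => Var.succ x) : Sub L Γ (m :: Γ)) = Sub.shift m := rfl

@[simp]
theorem zero_subst (h : HAHLang.Hom L) {Γ Δ : List ℕ} (σ : Sub L Γ Δ) :
    (zero h).subst σ = zero h := by
  rw [zero, Term.subst, args0_eq fun _ => _]; rfl

@[simp]
theorem succ_subst (h : HAHLang.Hom L) {Γ Δ : List ℕ} (σ : Sub L Γ Δ) (a : Term L Γ 0) :
    (succ h a).subst σ = succ h (a.subst σ) := by
  rw [succ, Term.subst, args1_eq fun _ => _]; rfl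

@[simp]
theorem add_subst (h : HAHLang.Hom L) {Γ Δ : List ℕ} (σ : Sub L Γ Δ) (a b : Term L Γ 0) :
    (add h a b).subst σ = add h (a.subst σ) (b.subst σ) := by
  rw [add, Term.subst, args2_eq fun _ => _]; rfl

@[simp]
theorem mul_subst (h : HAHLang.Hom L) {Γ Δ : List ℕ} (σ : Sub L Γ Δ) (a b : Term L Γ 0) :
    (mul h a b).subst σ = mul h (a.subst σ) (b.subst σ) := by
  rw [mul, Term.subst, args2_eq fun _ => _]; rfl

@[simp]
theorem app_subst {Γ Δ : List ℕ} (σ : Sub HAHPLang Γ Δ) (a b : Term HAHPLang Γ 0) :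
    (app a b).subst σ = app (a.subst σ) (b.subst σ) :=
  congrArg (Term.fn (L := HAHPLang) HAHPFn.app) (args2_eq _)

@[simp]
theorem kC_subst {Γ Δ : List ℕ} (σ : Sub HAHPLang Γ Δ) : kC.subst σ = kC :=
  congrArg (Term.fn (L := HAHPLang) HAHPFn.kC) (args0_eq _)

@[simp]
theorem sC_subst {Γ Δ : List ℕ} (σ : Sub HAHPLang Γ Δ) : sC.subst σ = sC :=
  congrArg (Term.fn (L := HAHPLang) HAHPFn.sC) (args0_eq _)

@[simp]
theorem sucC_subst {Γ Δ : List ℕ} (σ : Sub HAHPLang Γ Δ) : sucC.subst σ = sucC :=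
  congrArg (Term.fn (L := HAHPLang) HAHPFn.sucC) (args0_eq _)

@[simp]
theorem recC_subst {Γ Δ : List ℕ} (σ : Sub HAHPLang Γ Δ) : recC.subst σ = recC :=
  congrArg (Term.fn (L := HAHPLang) HAHPFn.recC) (args0_eq _)

end Simplification

/-! ### The axioms of HAHP are closed under substitution -/

theorem ArithAxiom.subst {L : Signature} {h : HAHLang.Hom L} {Γ Δ : List ℕ} {A : Formula L Γ}
    (hA : ArithAxiom h Γ A) (σ : Sub L Γ Δ) : ArithAxiom h Δ (A.subst σ) := by
  cases hA <;> simp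
  · exact .succ_ne_zero
  · exact .succ_inj
  · exact .zero_add
  · exact .succ_add
  · exact .zero_mul
  · exact .succ_mul
  · exact .zero_defd
  · exact .succ_defd
  · exact .add_defd
  · exact .mul_defd

/-- A substitution turns an instance of a scheme into the instance for the substituted formula, and
the remaining axioms are closed. Arbitrary terms are allowed, not only variables, because forcing
interprets the axioms under an assignment of terms. -/
theorem HAHPAxiom.subst {Γ Δ : List ℕ} {A : Formula HAHPLang Γ}
    (hA : HAHPAxiom Γ A) (σ : Sub HAHPLang Γ Δ) : HAHPAxiom Δ (A.subst σ) := by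
  cases hA with
  | ext n => simpa [extensionality, Formula.iff] using HAHPAxiom.ext (Γ := Δ) n
  | @comp n P =>
    have := HAHPAxiom.comp (P.subst (σ.lift n))
    simpa [comprehension, Formula.iff] using this
  | arith h => exact .arith (h.subst σ)
  | ind B =>
    have := HAHPAxiom.ind (B.subst (σ.lift 0))
    simpa [induction, Sub.succ_eq] using this
  | k_eq => simpa using HAHPAxiom.k_eq (Γ := Δ)
  | s_defd => simpa using HAHPAxiom.s_defd (Γ := Δ)
  | s_eq => simpa [Formula.keq] using HAHPAxiom.s_eq (Γ := Δ)
  | suc_eq => simpa using HAHPAxiom.suc_eq (Γ := Δ)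
  | rec_zero => simpa using HAHPAxiom.rec_zero (Γ := Δ)
  | rec_succ => simpa [Formula.keq] using HAHPAxiom.rec_succ (Γ := Δ)

theorem HAHP.renameClosed : Theory.RenameClosed HAHP := by
  intro Γ Δ ρ A hA
  rw [Formula.rename_eq_subst]
  exact HAHPAxiom.subst hA _

/-! ### Derived rules of HAHP -/

notation:45 Θ:46 " ⊢ₕ " A:46 => Provable HAHP Θ A

notation "𝐒" => succ HAHLang.toHAHP

notation "𝐎" => zero HAHLang.toHAHP

section Rules

variable {Γ : List ℕ} {Θ : List (Formula HAHPLang Γ)}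

theorem Provable.weaken {A : Formula HAHPLang Γ} (n : ℕ) (d : Θ ⊢ₕ A) :
    Θ.map (Formula.weaken n) ⊢ₕ A.subst (Sub.shift n) := by
  rw [← Formula.weaken_eq_subst]
  exact d.rename HAHP.renameClosed _

/-- In this and the following rules the enlarged list of hypotheses is an arbitrary `Θ'`, known only
through a map that transports every consequence of `Θ` to it. Earlier facts are carried into a
subproof by applying this map. -/
theorem all_intro {n : ℕ} {B : Formula HAHPLang (n :: Γ)}
    (d : ∀ Θ' : List (Formula HAHPLang (n :: Γ)),
      (∀ {A}, Θ ⊢ₕ A → Θ' ⊢ₕ A.subst (Sub.shift n)) → Θ' ⊢ₕ B) : Θ ⊢ₕ .all n B :=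
  .allI (d _ (Provable.weaken n))

theorem imp_intro {A B : Formula HAHPLang Γ}
    (d : ∀ Θ' : List (Formula HAHPLang Γ), (∀ {C}, Θ ⊢ₕ C → Θ' ⊢ₕ C) → Θ' ⊢ₕ A → Θ' ⊢ₕ B) :
    Θ ⊢ₕ .imp A B :=
  .impI (d _ Provable.cons (.hyp (by simp)))

theorem or_elim {A B C : Formula HAHPLang Γ} (h : Θ ⊢ₕ .or A B)
    (d₁ : ∀ Θ' : List (Formula HAHPLang Γ), (∀ {D}, Θ ⊢ₕ D → Θ' ⊢ₕ D) → Θ' ⊢ₕ A → Θ' ⊢ₕ C)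
    (d₂ : ∀ Θ' : List (Formula HAHPLang Γ), (∀ {D}, Θ ⊢ₕ D → Θ' ⊢ₕ D) → Θ' ⊢ₕ B → Θ' ⊢ₕ C) :
    Θ ⊢ₕ C :=
  .orE h (d₁ _ Provable.cons (.hyp (by simp))) (d₂ _ Provable.cons (.hyp (by simp)))

theorem ex_elim {n : ℕ} {B : Formula HAHPLang (n :: Γ)} {C : Formula HAHPLang Γ}
    (h : Θ ⊢ₕ .ex n B)
    (d : ∀ Θ' : List (Formula HAHPLang (n :: Γ)),
      (∀ {A}, Θ ⊢ₕ A → Θ' ⊢ₕ A.subst (Sub.shift n)) → Θ' ⊢ₕ B → Θ' ⊢ₕ C.subst (Sub.shift n)) :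
    Θ ⊢ₕ C := by
  refine .exE h ?_
  rw [Formula.weaken_eq_subst]
  exact d _ (fun e => (e.weaken n).cons) (.hyp (by simp))

theorem all_elim {n : ℕ} {B : Formula HAHPLang (n :: Γ)} (h : Θ ⊢ₕ .all n B)
    (a : Term HAHPLang Γ n) (ha : Θ ⊢ₕ .defd a) : Θ ⊢ₕ B.subst (Sub.cons a Sub.id) := by
  rw [← Formula.inst_eq_subst]
  exact .allE a h ha

theorem ex_intro {n : ℕ} {B : Formula HAHPLang (n :: Γ)}
    (a : Term HAHPLang Γ n) (ha : Θ ⊢ₕ .defd a) (h : Θ ⊢ₕ B.subst (Sub.cons a Sub.id)) :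
    Θ ⊢ₕ .ex n B := by
  rw [← Formula.inst_eq_subst] at h
  exact .exI a h ha

theorem eq_elim {n : ℕ} {a b : Term HAHPLang Γ n} (B : Formula HAHPLang (n :: Γ))
    (h : Θ ⊢ₕ .eq a b) (hB : Θ ⊢ₕ B.subst (Sub.cons a Sub.id)) :
    Θ ⊢ₕ B.subst (Sub.cons b Sub.id) := by
  rw [← Formula.inst_eq_subst] at hB ⊢
  exact .eqE B h hB

theorem eq_symm {n : ℕ} {a b : Term HAHPLang Γ n} (h : Θ ⊢ₕ .eq a b) : Θ ⊢ₕ .eq b a := by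
  simpa using eq_elim (.eq v0 (a.subst (Sub.shift n))) h (by simpa using Provable.eqI h.defdEq₁)

theorem eq_trans {n : ℕ} {a b c : Term HAHPLang Γ n} (h : Θ ⊢ₕ .eq a b) (h' : Θ ⊢ₕ .eq b c) :
    Θ ⊢ₕ .eq a c := by
  simpa using eq_elim (.eq (a.subst (Sub.shift n)) v0) h' (by simpa using h)

theorem succ_congr {a b : Term HAHPLang Γ 0} (h : Θ ⊢ₕ .eq a b) (ha : Θ ⊢ₕ .defd (𝐒 a)) :
    Θ ⊢ₕ .eq (𝐒 a) (𝐒 b) := by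
  simpa using eq_elim (.eq (𝐒 (a.subst (Sub.shift 0))) (𝐒 v0)) h
    (by simpa using Provable.eqI ha)

theorem app_congr {a a' b b' : Term HAHPLang Γ 0} (h : Θ ⊢ₕ .eq a a') (h' : Θ ⊢ₕ .eq b b')
    (hd : Θ ⊢ₕ .defd (app a b)) : Θ ⊢ₕ .eq (app a b) (app a' b') := by
  have h₁ : Θ ⊢ₕ .eq (app a b) (app a' b) := by
    simpa using eq_elim
      (.eq (app (a.subst (Sub.shift 0)) (b.subst (Sub.shift 0))) (app v0 (b.subst (Sub.shift 0)))) h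
      (by simpa using Provable.eqI hd)
  simpa using eq_elim (.eq (app (a.subst (Sub.shift 0)) (b.subst (Sub.shift 0)))
    (app (a'.subst (Sub.shift 0)) v0)) h' (by simpa using h₁)

theorem app_congr_left {a a' b : Term HAHPLang Γ 0} (h : Θ ⊢ₕ .eq a a')
    (hd : Θ ⊢ₕ .defd (app a b)) : Θ ⊢ₕ .eq (app a b) (app a' b) :=
  app_congr h (.eqI (.defdFn (L := HAHPLang) (args := args2 a b) (f := HAHPFn.app)
    ⟨1, Nat.one_lt_two⟩ hd)) hd

theorem defd_app_left {a b : Term HAHPLang Γ 0} (hd : Θ ⊢ₕ .defd (app a b)) : Θ ⊢ₕ .defd a :=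
  .defdFn (L := HAHPLang) (args := args2 a b) (f := HAHPFn.app) ⟨0, Nat.zero_lt_two⟩ hd

theorem defd_app_right {a b : Term HAHPLang Γ 0} (hd : Θ ⊢ₕ .defd (app a b)) : Θ ⊢ₕ .defd b :=
  .defdFn (L := HAHPLang) (args := args2 a b) (f := HAHPFn.app) ⟨1, Nat.one_lt_two⟩ hd

theorem defd_of_defd_succ {a : Term HAHPLang Γ 0} (hd : Θ ⊢ₕ .defd (𝐒 a)) : Θ ⊢ₕ .defd a :=
  .defdFn (L := HAHPLang) (args := args1 a) (f := .ofHAH .succ) ⟨0, Nat.zero_lt_one⟩ hd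

/-! ### Instances of the axioms -/

theorem defd_zero : Θ ⊢ₕ .defd 𝐎 := .ax (HAHPAxiom.arith .zero_defd)

theorem defd_succ {a : Term HAHPLang Γ 0} (ha : Θ ⊢ₕ .defd a) : Θ ⊢ₕ .defd (𝐒 a) := by
  simpa using all_elim (.ax (HAHPAxiom.arith .succ_defd)) a ha

theorem succ_ne_zero {a : Term HAHPLang Γ 0} {C : Formula HAHPLang Γ}
    (h : Θ ⊢ₕ .eq (𝐒 a) 𝐎) : Θ ⊢ₕ C := by
  have := all_elim (.ax (HAHPAxiom.arith .succ_ne_zero)) a (defd_of_defd_succ h.defdEq₁)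
  simp at this
  exact .botE (.impE this h)

theorem succ_inj {a b : Term HAHPLang Γ 0} (h : Θ ⊢ₕ .eq (𝐒 a) (𝐒 b)) : Θ ⊢ₕ .eq a b := by
  have := all_elim (.ax (HAHPAxiom.arith .succ_inj)) a (defd_of_defd_succ h.defdEq₁)
  simp at this
  have := all_elim this b (defd_of_defd_succ h.defdEq₂)
  simp at this
  exact .impE this h

theorem k_eq {a b : Term HAHPLang Γ 0} (ha : Θ ⊢ₕ .defd a) (hb : Θ ⊢ₕ .defd b) :
    Θ ⊢ₕ .eq (app (app kC a) b) a := by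
  have := all_elim (.ax HAHPAxiom.k_eq) a ha
  simp at this
  simpa using all_elim this b hb

theorem s_defd {a b : Term HAHPLang Γ 0} (ha : Θ ⊢ₕ .defd a) (hb : Θ ⊢ₕ .defd b) :
    Θ ⊢ₕ .defd (app (app sC a) b) := by
  have := all_elim (.ax HAHPAxiom.s_defd) a ha
  simp at this
  simpa using all_elim this b hb

theorem s_eq {a b c : Term HAHPLang Γ 0} (h : Θ ⊢ₕ .defd (app (app a c) (app b c))) :
    Θ ⊢ₕ .eq (app (app (app sC a) b) c) (app (app a c) (app b c)) := by
  have := all_elim (.ax HAHPAxiom.s_eq) a (defd_app_left (defd_app_left h))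
  simp at this
  have := all_elim this b (defd_app_left (defd_app_right h))
  simp at this
  have := all_elim this c (defd_app_right (defd_app_left h))
  simp [Formula.keq] at this
  exact .impE this (.orI₂ h)

theorem suc_eq {a : Term HAHPLang Γ 0} (ha : Θ ⊢ₕ .defd a) : Θ ⊢ₕ .eq (app sucC a) (𝐒 a) := by
  simpa using all_elim (.ax HAHPAxiom.suc_eq) a ha

theorem rec_zero {a b : Term HAHPLang Γ 0} (ha : Θ ⊢ₕ .defd a) (hb : Θ ⊢ₕ .defd b) :
    Θ ⊢ₕ .eq (app (app (app recC a) b) 𝐎) a := by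
  have := all_elim (.ax HAHPAxiom.rec_zero) a ha
  simp at this
  simpa using all_elim this b hb

theorem rec_succ {a b c : Term HAHPLang Γ 0}
    (h : Θ ⊢ₕ .defd (app (app b c) (app (app (app recC a) b) c))) :
    Θ ⊢ₕ .eq (app (app (app recC a) b) (𝐒 c))
      (app (app b c) (app (app (app recC a) b) c)) := by
  have := all_elim (.ax HAHPAxiom.rec_succ) a
    (defd_app_right (defd_app_left (defd_app_left (defd_app_right h))))
  simp at this
  have := all_elim this b (defd_app_left (defd_app_left h))
  simp at this
  have := all_elim this c (defd_app_right (defd_app_left h))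
  simp [Formula.keq] at this
  exact .impE this (.orI₂ h)

theorem induct (B : Formula HAHPLang (0 :: Γ)) (h₀ : Θ ⊢ₕ B.subst (Sub.cons 𝐎 Sub.id))
    (h₁ : ∀ Θ' : List (Formula HAHPLang (0 :: Γ)),
      (∀ {A}, Θ ⊢ₕ A → Θ' ⊢ₕ A.subst (Sub.shift 0)) → Θ' ⊢ₕ B →
      Θ' ⊢ₕ B.subst (Sub.cons (𝐒 (.var .zero)) (Sub.shift 0)))
    (a : Term HAHPLang Γ 0) (ha : Θ ⊢ₕ .defd a) : Θ ⊢ₕ B.subst (Sub.cons a Sub.id) := by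
  refine all_elim (.impE (.ax (HAHPAxiom.ind B)) (.andI ?_ (all_intro fun Θ₁ w₁ =>
    imp_intro fun Θ₂ w₂ hB => ?_))) a ha
  · rwa [Formula.inst_eq_subst]
  · rw [Sub.succ_eq]
    exact h₁ Θ₂ (fun h => w₂ (w₁ h)) hB

/-- This decision is what permits a function to be treated by cases on its argument in an
intuitionistic setting. -/
theorem zero_or_succ {a : Term HAHPLang Γ 0} (ha : Θ ⊢ₕ .defd a) :
    Θ ⊢ₕ .or (.eq a 𝐎) (.ex 0 (.eq (a.subst (Sub.shift 0)) (𝐒 (.var .zero)))) := by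
  have := induct (Θ := Θ) (.or (.eq v0 𝐎) (.ex 0 (.eq v1 (𝐒 v0))))
    (.orI₁ (by simpa using Provable.eqI defd_zero))
    (fun Θ' w _ => by
      simp
      exact .orI₂ (ex_intro (.var .zero) (.defdVar _)
        (by simpa using Provable.eqI (defd_succ (.defdVar _))))) a ha
  simpa using this

/-! ### Updating a function at one argument -/

/-- `e` is a total function. -/
def total (e : Term HAHPLang Γ 0) : Formula HAHPLang Γ :=
  .all 0 (.defd (app (e.subst (Sub.shift 0)) v0))

@[simp]
theorem total_subst {Δ : List ℕ} (σ : Sub HAHPLang Γ Δ) (e : Term HAHPLang Γ 0) :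
    (total e).subst σ = total (e.subst σ) := by
  simp [total]

theorem total_elim {e a : Term HAHPLang Γ 0} (h : Θ ⊢ₕ total e) (ha : Θ ⊢ₕ .defd a) :
    Θ ⊢ₕ .defd (app e a) := by
  simpa using all_elim h a ha

/-- The function with value `a` at `0` and values `t z` at `S z`. -/
def prepend (a t : Term HAHPLang Γ 0) : Term HAHPLang Γ 0 :=
  app (app recC a) (app (app sC (app kC kC)) t)

@[simp]
theorem prepend_subst {Δ : List ℕ} (σ : Sub HAHPLang Γ Δ) (a t : Term HAHPLang Γ 0) :
    (prepend a t).subst σ = prepend (a.subst σ) (t.subst σ) := by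
  simp [prepend]

/-- The function `z ↦ e (S z)`. -/
def tail (e : Term HAHPLang Γ 0) : Term HAHPLang Γ 0 :=
  app (app sC (app kC e)) sucC

@[simp]
theorem tail_subst {Δ : List ℕ} (σ : Sub HAHPLang Γ Δ) (e : Term HAHPLang Γ 0) :
    (tail e).subst σ = tail (e.subst σ) := by
  simp [tail]

theorem defd_of_total {e : Term HAHPLang Γ 0} (h : Θ ⊢ₕ total e) : Θ ⊢ₕ .defd e :=
  defd_app_left (total_elim h defd_zero)

/-- No axiom says outright that the constant `k` is defined; strictness of application extracts it
from `k 0 0 = 0`. -/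
theorem defd_kC : Θ ⊢ₕ .defd kC :=
  defd_app_left (defd_app_left (k_eq defd_zero defd_zero).defdEq₁)

/-- The combinators compute `s (k e) suc a = (k e a) (suc a) = e (S a)`. -/
theorem tail_eq {e a : Term HAHPLang Γ 0} (h : Θ ⊢ₕ total e) (ha : Θ ⊢ₕ .defd a) :
    Θ ⊢ₕ .eq (app (tail e) a) (app e (𝐒 a)) := by
  have h₁ : Θ ⊢ₕ .eq (app e (𝐒 a)) (app (app (app kC e) a) (app sucC a)) :=
    app_congr (eq_symm (k_eq (defd_of_total h) ha)) (eq_symm (suc_eq ha))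
      (total_elim h (defd_succ ha))
  exact eq_trans (s_eq h₁.defdEq₂) (eq_symm h₁)

theorem tail_total {e : Term HAHPLang Γ 0} (h : Θ ⊢ₕ total e) : Θ ⊢ₕ total (tail e) :=
  all_intro fun Θ' w => by
    have := w h
    simp at this ⊢
    exact (tail_eq this (.defdVar _)).defdEq₁

/-- The step function of the recursion in `prepend` ignores the previous value `c`: `s (k k) t z c =
(k k z) (t z) c = k (t z) c = t z`. -/
theorem prepend_step_eq {t z c : Term HAHPLang Γ 0} (ht : Θ ⊢ₕ total t) (hz : Θ ⊢ₕ .defd z)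
    (hc : Θ ⊢ₕ .defd c) :
    Θ ⊢ₕ .eq (app (app (app (app sC (app kC kC)) t) z) c) (app t z) := by
  have hk : Θ ⊢ₕ .eq kC (app (app kC kC) z) := eq_symm (k_eq defd_kC hz)
  have htz := total_elim ht hz
  have h₁ : Θ ⊢ₕ .eq (app (app kC (app t z)) c) (app t z) := k_eq htz hc
  have h₂ := app_congr_left hk (defd_app_left h₁.defdEq₁)
  have h₃ := eq_trans h₂ (eq_symm (s_eq h₂.defdEq₂))
  exact eq_trans (eq_symm (app_congr_left h₃ h₁.defdEq₁)) h₁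

theorem prepend_zero {a t : Term HAHPLang Γ 0} (ha : Θ ⊢ₕ .defd a) (ht : Θ ⊢ₕ total t) :
    Θ ⊢ₕ .eq (app (prepend a t) 𝐎) a :=
  rec_zero ha (defd_app_left (defd_app_left (prepend_step_eq ht defd_zero defd_zero).defdEq₁))

/-- Although the step function discards the previous value, strictness requires that value to be
defined before the recursion equation can be used. This is why `prepend_total` needs an induction.
-/
theorem prepend_succ_of_defd {a t z : Term HAHPLang Γ 0} (ht : Θ ⊢ₕ total t)
    (hz : Θ ⊢ₕ .defd (app (prepend a t) z)) :
    Θ ⊢ₕ .eq (app (prepend a t) (𝐒 z)) (app t z) := by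
  have h := prepend_step_eq ht (defd_app_right hz) hz
  exact eq_trans (rec_succ h.defdEq₁) h

theorem prepend_total {a t : Term HAHPLang Γ 0} (ha : Θ ⊢ₕ .defd a) (ht : Θ ⊢ₕ total t) :
    Θ ⊢ₕ total (prepend a t) :=
  all_intro fun Θ₁ w₁ => by
    have ha := w₁ ha
    have ht := w₁ ht
    simp at ha ht ⊢
    have := induct (Θ := Θ₁) (.defd (app ((prepend a t).subst ((Sub.shift 0).comp (Sub.shift 0))) v0))
      (by simpa using (prepend_zero ha ht).defdEq₁)
      (fun Θ₂ w₂ h => by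
        have ht := w₂ ht
        simp at h ht ⊢
        exact (prepend_succ_of_defd ht h).defdEq₁) (.var .zero) (.defdVar _)
    simpa using this

theorem prepend_succ {a t z : Term HAHPLang Γ 0} (ha : Θ ⊢ₕ .defd a) (ht : Θ ⊢ₕ total t)
    (hz : Θ ⊢ₕ .defd z) : Θ ⊢ₕ .eq (app (prepend a t) (𝐒 z)) (app t z) :=
  prepend_succ_of_defd ht (total_elim (prepend_total ha ht) hz)

/-- `e'` has value `a` at `x` and agrees with `e` at all other arguments. -/
def isUpdate (e x a e' : Term HAHPLang Γ 0) : Formula HAHPLang Γ :=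
  .and (.eq (app e' x) a) (.all 0 (.or (.eq v0 (x.subst (Sub.shift 0)))
    (.eq (app (e'.subst (Sub.shift 0)) v0) (app (e.subst (Sub.shift 0)) v0))))

@[simp]
theorem isUpdate_subst {Δ : List ℕ} (σ : Sub HAHPLang Γ Δ) (e x a e' : Term HAHPLang Γ 0) :
    (isUpdate e x a e').subst σ =
      isUpdate (e.subst σ) (x.subst σ) (a.subst σ) (e'.subst σ) := by
  simp [isUpdate]

/-- Every total function can be given any value at `x`. -/
def updatable (x : Term HAHPLang Γ 0) : Formula HAHPLang Γ :=
  .all 0 (.all 0 (.imp (total v1)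
    (.ex 0 (isUpdate v2 (x.subst (.comp (Sub.shift 0) (.comp (Sub.shift 0) (Sub.shift 0)))) v1 v0))))

@[simp]
theorem updatable_subst {Δ : List ℕ} (σ : Sub HAHPLang Γ Δ) (x : Term HAHPLang Γ 0) :
    (updatable x).subst σ = updatable (x.subst σ) := by
  simp [updatable]

theorem updatable_elim {x e a : Term HAHPLang Γ 0} (h : Θ ⊢ₕ updatable x) (he : Θ ⊢ₕ total e)
    (ha : Θ ⊢ₕ .defd a) : Θ ⊢ₕ .ex 0 (isUpdate (e.subst (Sub.shift 0)) (x.subst (Sub.shift 0))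
      (a.subst (Sub.shift 0)) (.var .zero)) := by
  have := all_elim h e (defd_of_total he)
  simp at this
  have := all_elim this a ha
  simp at this
  exact .impE this he

/-- The update of `e` at `0` keeps the tail of `e` and prepends the new value. -/
theorem updatable_zero : Θ ⊢ₕ updatable 𝐎 := by
  refine all_intro fun Θ₁ _ => all_intro fun Θ₂ _ => imp_intro fun Θ₃ _ he => ?_
  simp at he ⊢
  have ht := tail_total he
  have ha : Θ₃ ⊢ₕ .defd (.var .zero) := .defdVar _
  refine ex_intro _ (defd_of_total (prepend_total ha ht)) ?_
  simp
  refine .andI (prepend_zero ha ht) (all_intro fun Θ₄ w₄ => ?_)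
  simp
  have he := w₄ he
  have ht := w₄ ht
  have ha := w₄ ha
  simp at he ht ha
  refine or_elim (zero_or_succ (.defdVar .zero)) (fun Θ₅ w₅ h => .orI₁ h) fun Θ₅ w₅ h => .orI₂ ?_
  refine ex_elim h fun Θ₆ w₆ h => ?_
  have he := w₆ (w₅ he)
  have ht := w₆ (w₅ ht)
  have ha := w₆ (w₅ ha)
  simp at h he ht ha ⊢
  have hz : Θ₆ ⊢ₕ .defd (.var .zero) := .defdVar _
  have h₁ := app_congr (.eqI (defd_of_total (prepend_total ha ht))) h
    (total_elim (prepend_total ha ht) h.defdEq₁)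
  have h₂ := app_congr (.eqI (defd_of_total he)) (eq_symm h) (total_elim he (defd_succ hz))
  exact eq_trans h₁ (eq_trans (prepend_succ ha ht hz) (eq_trans (tail_eq he hz) h₂))

theorem isUpdate_cases {e x a e' z : Term HAHPLang Γ 0} (h : Θ ⊢ₕ isUpdate e x a e')
    (hz : Θ ⊢ₕ .defd z) : Θ ⊢ₕ .or (.eq z x) (.eq (app e' z) (app e z)) := by
  simpa using all_elim h.andE₂ z hz

/-- At `x` the prescribed value is defined; elsewhere the value is that of `e`. -/
theorem isUpdate_total {e x a e' : Term HAHPLang Γ 0} (h : Θ ⊢ₕ isUpdate e x a e')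
    (he : Θ ⊢ₕ total e) : Θ ⊢ₕ total e' := by
  refine all_intro fun Θ₁ w₁ => ?_
  have h := w₁ h
  have he := w₁ he
  simp at h he ⊢
  refine or_elim (isUpdate_cases h (.defdVar .zero)) (fun Θ₂ w₂ hz => ?_)
    fun Θ₂ w₂ hz => hz.defdEq₁
  have hx := (w₂ h).andE₁
  exact (app_congr (.eqI (defd_app_left hx.defdEq₁)) (eq_symm hz) hx.defdEq₁).defdEq₂

/-- The update of `e` at `S x` is obtained by updating the tail of `e` at `x` and prepending the old
value `e 0`. -/
theorem updatable_succ {x : Term HAHPLang Γ 0} (hu : Θ ⊢ₕ updatable x) (hx : Θ ⊢ₕ .defd x) :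
    Θ ⊢ₕ updatable (𝐒 x) := by
  refine all_intro fun Θ₁ w₁ => all_intro fun Θ₂ w₂ => imp_intro fun Θ₃ w₃ he => ?_
  have hu := w₃ (w₂ (w₁ hu))
  have hx := w₃ (w₂ (w₁ hx))
  simp at he hu hx ⊢
  refine ex_elim (updatable_elim hu (tail_total he) (.defdVar .zero)) fun Θ₄ w₄ ht => ?_
  have he := w₄ he
  have hx := w₄ hx
  simp at he hx ht ⊢
  have ht' := isUpdate_total ht (tail_total he)
  have he₀ := total_elim he defd_zero
  have hp := prepend_total he₀ ht'
  refine ex_intro _ (defd_of_total hp) ?_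
  simp
  refine .andI (eq_trans (prepend_succ he₀ ht' hx) ht.andE₁) (all_intro fun Θ₅ w₅ => ?_)
  have he := w₅ he
  have hp := w₅ hp
  have ht := w₅ ht
  have ht' := w₅ ht'
  have he₀ := w₅ he₀
  simp at he hp ht ht' he₀ ⊢
  -- At `0` both functions have the value `e 0`. At a successor `S y` the update of the tail decides
  -- between `y = x` and agreement with `e`.
  refine or_elim (zero_or_succ (.defdVar .zero)) (fun Θ₆ w₆ hz => .orI₂ ?_) fun Θ₆ w₆ hz => ?_
  · have h₁ := app_congr (.eqI (defd_of_total (w₆ hp))) hz (total_elim (w₆ hp) (.defdVar .zero))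
    have h₂ := app_congr (.eqI (defd_of_total (w₆ he))) (eq_symm hz) (w₆ he₀)
    exact eq_trans h₁ (eq_trans (prepend_zero (w₆ he₀) (w₆ ht')) h₂)
  · refine ex_elim hz fun Θ₇ w₇ hz => ?_
    have he := w₇ (w₆ he)
    have hp := w₇ (w₆ hp)
    have ht := w₇ (w₆ ht)
    have ht' := w₇ (w₆ ht')
    have he₀ := w₇ (w₆ he₀)
    simp at he hp ht ht' he₀ hz ⊢
    have hy : Θ₇ ⊢ₕ .defd (.var .zero) := .defdVar _
    refine or_elim (isUpdate_cases ht hy) (fun Θ₈ w₈ h => .orI₁ ?_) fun Θ₈ w₈ h => .orI₂ ?_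
    · exact eq_trans (w₈ hz) (succ_congr h (w₈ (defd_succ hy)))
    · have h₁ := app_congr (.eqI (defd_of_total hp)) hz (total_elim hp hz.defdEq₁)
      have h₂ := app_congr (.eqI (defd_of_total he)) (eq_symm hz) (total_elim he (defd_succ hy))
      exact eq_trans (w₈ h₁) (eq_trans (w₈ (prepend_succ he₀ ht' hy))
        (eq_trans h (eq_trans (w₈ (tail_eq he hy)) (w₈ h₂))))

theorem updatable_of_defd {x : Term HAHPLang Γ 0} (hx : Θ ⊢ₕ .defd x) : Θ ⊢ₕ updatable x := by
  simpa using induct (Θ := Θ) (updatable v0) (by simpa using updatable_zero)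
    (fun Θ' _ h => by simpa using updatable_succ h (.defdVar .zero)) x hx

end Rules

/-! ### Conditions -/

/-- The substitution for the empty context. -/
def Sub.empty {L : Signature} {Γ : List ℕ} : Sub L [] Γ := fun _ x => nomatch x

@[simp]
theorem Sub.empty_comp {L : Signature} {Γ Δ : List ℕ} (σ : Sub L Γ Δ) :
    Sub.empty.comp σ = Sub.empty := by
  funext n x; nomatch x

@[simp]
theorem Sub.cons_var_zero_shift {L : Signature} {Γ : List ℕ} {m : ℕ} :
    Sub.cons (.var .zero) (Sub.shift m) = (Sub.id : Sub L (m :: Γ) (m :: Γ)) := by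
  funext n x; cases x <;> rfl

section Conditions

variable (A : Formula HAHLang [0, 0]) {Γ : List ℕ} {Θ : List (Formula HAHPLang Γ)}

/-- The formula `A[t, u]`. -/
def instA (t u : Term HAHPLang Γ 0) : Formula HAHPLang Γ :=
  (A.map HAHLang.toHAHP).subst (Sub.cons u (Sub.cons t Sub.empty))

/-- `e` is a forcing condition: a total function whose positive values `S b` at `z` satisfy
`A[z, b]`; it is read as the partial choice function `z ↦ b`. -/
def cond (e : Term HAHPLang Γ 0) : Formula HAHPLang Γ :=
  .and (.defd e) (.all 0 (.or (.eq (app (e.subst (Sub.shift 0)) v0) 𝐎)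
    (.ex 0 (.and (.eq (app (e.subst (.comp (Sub.shift 0) (Sub.shift 0))) v1) (𝐒 v0))
      (instA A v1 v0)))))

/-- The partial function of `q` extends that of `p`. -/
def extend (q p : Term HAHPLang Γ 0) : Formula HAHPLang Γ :=
  .all 0 (.all 0 (.imp (.eq (app (p.subst (.comp (Sub.shift 0) (Sub.shift 0))) v1) (𝐒 v0))
    (.eq (app (q.subst (.comp (Sub.shift 0) (Sub.shift 0))) v1) (𝐒 v0))))

/-- `q` is a condition below `p`. -/
def ext (q p : Term HAHPLang Γ 0) : Formula HAHPLang Γ := .and (cond A q) (extend q p)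

/-- `F[q]` for all conditions `q` below `p`. -/
def below (p : Term HAHPLang Γ 0) (F : Formula HAHPLang (0 :: Γ)) : Formula HAHPLang Γ :=
  .all 0 (.imp (ext A v0 (p.subst (Sub.shift 0))) F)

/-- `F[q]` for some condition `q` below `p`. -/
def exBelow (p : Term HAHPLang Γ 0) (F : Formula HAHPLang (0 :: Γ)) : Formula HAHPLang Γ :=
  .ex 0 (.and (ext A v0 (p.subst (Sub.shift 0))) F)

/-- `F[r]` for densely many conditions `r` below `p`. -/
def dense (p : Term HAHPLang Γ 0) (F : Formula HAHPLang (0 :: Γ)) : Formula HAHPLang Γ :=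
  below A p (exBelow A v0 (F.subst (Sub.cons v0 (.comp (Sub.shift 0) (Sub.shift 0)))))

section Subst

variable {Δ : List ℕ} (σ : Sub HAHPLang Γ Δ)

@[simp]
theorem instA_subst (t u : Term HAHPLang Γ 0) :
    (instA A t u).subst σ = instA A (t.subst σ) (u.subst σ) := by
  simp [instA]

@[simp]
theorem cond_subst (e : Term HAHPLang Γ 0) : (cond A e).subst σ = cond A (e.subst σ) := by
  simp [cond]

@[simp]
theorem extend_subst (q p : Term HAHPLang Γ 0) :
    (extend q p).subst σ = extend (q.subst σ) (p.subst σ) := by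
  simp [extend]

@[simp]
theorem ext_subst (q p : Term HAHPLang Γ 0) :
    (ext A q p).subst σ = ext A (q.subst σ) (p.subst σ) := by
  simp [ext]

@[simp]
theorem below_subst (p : Term HAHPLang Γ 0) (F : Formula HAHPLang (0 :: Γ)) :
    (below A p F).subst σ =
      below A (p.subst σ) (F.subst (Sub.cons v0 (σ.comp (Sub.shift 0)))) := by
  simp [below]

@[simp]
theorem exBelow_subst (p : Term HAHPLang Γ 0) (F : Formula HAHPLang (0 :: Γ)) :
    (exBelow A p F).subst σ =
      exBelow A (p.subst σ) (F.subst (Sub.cons v0 (σ.comp (Sub.shift 0)))) := by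
  simp [exBelow]

@[simp]
theorem dense_subst (p : Term HAHPLang Γ 0) (F : Formula HAHPLang (0 :: Γ)) :
    (dense A p F).subst σ =
      dense A (p.subst σ) (F.subst (Sub.cons v0 (σ.comp (Sub.shift 0)))) := by
  simp [dense]

end Subst

/-! ### The order on conditions -/

variable {A}

theorem cond_cases {e z : Term HAHPLang Γ 0} (h : Θ ⊢ₕ cond A e) (hz : Θ ⊢ₕ .defd z) :
    Θ ⊢ₕ .or (.eq (app e z) 𝐎)
      (.ex 0 (.and (.eq (app (e.subst (Sub.shift 0)) (z.subst (Sub.shift 0))) (𝐒 (.var .zero)))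
        (instA A (z.subst (Sub.shift 0)) (.var .zero)))) := by
  simpa using all_elim h.andE₂ z hz

theorem cond_total {e : Term HAHPLang Γ 0} (h : Θ ⊢ₕ cond A e) : Θ ⊢ₕ total e := by
  refine all_intro fun Θ₁ w₁ => ?_
  have h := w₁ h
  simp at h ⊢
  refine or_elim (cond_cases h (.defdVar .zero)) (fun _ _ h => h.defdEq₁) fun Θ₂ _ h => ?_
  refine ex_elim h fun Θ₃ _ h => ?_
  simpa using h.andE₁.defdEq₁

theorem extend_elim {q p z b : Term HAHPLang Γ 0} (h : Θ ⊢ₕ extend q p)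
    (hz : Θ ⊢ₕ .eq (app p z) (𝐒 b)) : Θ ⊢ₕ .eq (app q z) (𝐒 b) := by
  have := all_elim h z (defd_app_right hz.defdEq₁)
  simp at this
  have := all_elim this b (defd_of_defd_succ hz.defdEq₂)
  simp at this
  exact .impE this hz

theorem extend_intro {q p : Term HAHPLang Γ 0}
    (h : ∀ Θ' : List (Formula HAHPLang (0 :: 0 :: Γ)),
      (∀ {B}, Θ ⊢ₕ B → Θ' ⊢ₕ B.subst ((Sub.shift 0).comp (Sub.shift 0))) →
      Θ' ⊢ₕ .eq (app (p.subst ((Sub.shift 0).comp (Sub.shift 0))) (.var (.succ .zero)))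
        (𝐒 (.var .zero)) →
      Θ' ⊢ₕ .eq (app (q.subst ((Sub.shift 0).comp (Sub.shift 0))) (.var (.succ .zero)))
        (𝐒 (.var .zero))) : Θ ⊢ₕ extend q p :=
  all_intro fun Θ₁ w₁ => all_intro fun Θ₂ w₂ => imp_intro fun Θ₃ w₃ hz =>
    h Θ₃ (fun {B} hB => by simpa using w₃ (w₂ (w₁ hB))) hz

theorem ext_refl {p : Term HAHPLang Γ 0} (hp : Θ ⊢ₕ cond A p) : Θ ⊢ₕ ext A p p :=
  .andI hp (extend_intro fun _ _ h => h)

theorem ext_trans {r q p : Term HAHPLang Γ 0} (h : Θ ⊢ₕ ext A r q) (h' : Θ ⊢ₕ ext A q p) :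
    Θ ⊢ₕ ext A r p :=
  .andI h.andE₁ (extend_intro fun Θ' w hz => by
    have h := w h.andE₂
    have h' := w h'.andE₂
    simp at h h'
    exact extend_elim h (extend_elim h' hz))

/-! ### Universal, existential and dense quantification over conditions -/

theorem below_intro {p : Term HAHPLang Γ 0} {F : Formula HAHPLang (0 :: Γ)}
    (h : ∀ Θ' : List (Formula HAHPLang (0 :: Γ)),
      (∀ {B}, Θ ⊢ₕ B → Θ' ⊢ₕ B.subst (Sub.shift 0)) →
      Θ' ⊢ₕ ext A (.var .zero) (p.subst (Sub.shift 0)) → Θ' ⊢ₕ F) : Θ ⊢ₕ below A p F :=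
  all_intro fun _ w₁ => imp_intro fun Θ₂ w₂ hq => h Θ₂ (fun hB => w₂ (w₁ hB)) hq

theorem below_elim {p q : Term HAHPLang Γ 0} {F : Formula HAHPLang (0 :: Γ)}
    (h : Θ ⊢ₕ below A p F) (hq : Θ ⊢ₕ ext A q p) : Θ ⊢ₕ F.subst (Sub.cons q Sub.id) := by
  have := all_elim h q hq.andE₁.andE₁
  simp at this
  exact .impE this hq

theorem below_ext {p q : Term HAHPLang Γ 0} {F : Formula HAHPLang (0 :: Γ)}
    (h : Θ ⊢ₕ below A p F) (hq : Θ ⊢ₕ ext A q p) : Θ ⊢ₕ below A q F :=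
  below_intro fun Θ₁ w₁ hr => by
    have h := w₁ h
    have hq := w₁ hq
    simp only [below_subst, ext_subst] at h hq
    simpa using below_elim h (ext_trans hr hq)

theorem exBelow_intro {p q : Term HAHPLang Γ 0} {F : Formula HAHPLang (0 :: Γ)}
    (hq : Θ ⊢ₕ ext A q p) (h : Θ ⊢ₕ F.subst (Sub.cons q Sub.id)) : Θ ⊢ₕ exBelow A p F :=
  ex_intro q hq.andE₁.andE₁ (.andI (by simpa using hq) h)

theorem exBelow_elim {p : Term HAHPLang Γ 0} {F : Formula HAHPLang (0 :: Γ)}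
    {C : Formula HAHPLang Γ} (h : Θ ⊢ₕ exBelow A p F)
    (d : ∀ Θ' : List (Formula HAHPLang (0 :: Γ)),
      (∀ {B}, Θ ⊢ₕ B → Θ' ⊢ₕ B.subst (Sub.shift 0)) →
      Θ' ⊢ₕ ext A (.var .zero) (p.subst (Sub.shift 0)) → Θ' ⊢ₕ F → Θ' ⊢ₕ C.subst (Sub.shift 0)) :
    Θ ⊢ₕ C :=
  ex_elim h fun Θ' w h' => d Θ' w h'.andE₁ h'.andE₂

theorem dense_elim {p q : Term HAHPLang Γ 0} {F : Formula HAHPLang (0 :: Γ)}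
    {C : Formula HAHPLang Γ} (h : Θ ⊢ₕ dense A p F) (hq : Θ ⊢ₕ ext A q p)
    (d : ∀ Θ' : List (Formula HAHPLang (0 :: Γ)),
      (∀ {B}, Θ ⊢ₕ B → Θ' ⊢ₕ B.subst (Sub.shift 0)) →
      Θ' ⊢ₕ ext A (.var .zero) (q.subst (Sub.shift 0)) → Θ' ⊢ₕ F → Θ' ⊢ₕ C.subst (Sub.shift 0)) :
    Θ ⊢ₕ C := by
  have := below_elim h hq
  simp at this
  exact exBelow_elim this d

theorem dense_ext {p q : Term HAHPLang Γ 0} {F : Formula HAHPLang (0 :: Γ)}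
    (h : Θ ⊢ₕ dense A p F) (hq : Θ ⊢ₕ ext A q p) : Θ ⊢ₕ dense A q F :=
  below_ext h hq

theorem dense_of_below {p : Term HAHPLang Γ 0} {F : Formula HAHPLang (0 :: Γ)}
    (h : Θ ⊢ₕ below A p F) : Θ ⊢ₕ dense A p F :=
  below_intro fun Θ₁ w₁ hq => exBelow_intro (ext_refl hq.andE₁) (by
    have h := w₁ h
    simp only [below_subst] at h
    simpa using below_elim h hq)

theorem dense_map {p : Term HAHPLang Γ 0} {F G : Formula HAHPLang (0 :: Γ)}
    (h : Θ ⊢ₕ dense A p F) (g : Θ ⊢ₕ below A p (.imp F G)) : Θ ⊢ₕ dense A p G :=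
  below_intro fun Θ₁ w₁ hq => by
    have h := w₁ h
    have g := w₁ g
    simp only [dense_subst, below_subst] at h g
    refine dense_elim h hq fun Θ₂ w₂ hr hF => ?_
    have g := w₂ g
    have hq := w₂ hq
    simp at g hr hF hq ⊢
    have := below_elim g (ext_trans hr hq)
    simp at this
    exact exBelow_intro hr (by simpa using Provable.impE this hF)

/-- Two successive choices of a smaller condition compose to one, by transitivity of the order. -/
theorem dense_join {p : Term HAHPLang Γ 0} {F : Formula HAHPLang (0 :: Γ)}
    (h : Θ ⊢ₕ dense A p
      (dense A (.var .zero) (F.subst (Sub.cons (.var .zero) (.comp (Sub.shift 0) (Sub.shift 0)))))) :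
    Θ ⊢ₕ dense A p F :=
  below_intro fun Θ₁ w₁ hq => by
    have h := w₁ h
    simp only [dense_subst] at h
    refine dense_elim h hq fun Θ₂ w₂ hr h => ?_
    simp at h hr ⊢
    refine dense_elim h (ext_refl hr.andE₁) fun Θ₃ w₃ hr' hF => ?_
    have hr := w₃ hr
    simp at hr hr' hF ⊢
    exact exBelow_intro (ext_trans hr' hr) (by simpa using hF)

/-- Density provides at least one condition below `p`, since `p` is below itself, and `C` does not
depend on which one is taken. -/
theorem dense_const {p : Term HAHPLang Γ 0} {C : Formula HAHPLang Γ} (hp : Θ ⊢ₕ cond A p)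
    (h : Θ ⊢ₕ dense A p (C.subst (Sub.shift 0))) : Θ ⊢ₕ C :=
  dense_elim h (ext_refl hp) fun _ _ _ h => h

/-! ### Values of conditions and one-point extensions -/

theorem instA_congr {x x' y y' : Term HAHPLang Γ 0} (hx : Θ ⊢ₕ .eq x x') (hy : Θ ⊢ₕ .eq y y')
    (h : Θ ⊢ₕ instA A x y) : Θ ⊢ₕ instA A x' y' := by
  have h₁ : Θ ⊢ₕ instA A x' y := by
    simpa using eq_elim (instA A v0 (y.subst (Sub.shift 0))) hx (by simpa using h)
  simpa using eq_elim (instA A (x'.subst (Sub.shift 0)) v0) hy (by simpa using h₁)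

/-- The everywhere undefined partial function is a condition. -/
theorem cond_empty : Θ ⊢ₕ cond A (app kC 𝐎) := by
  refine .andI (defd_app_left (k_eq defd_zero defd_zero).defdEq₁) (all_intro fun Θ₁ _ => ?_)
  simp
  exact .orI₁ (k_eq defd_zero (.defdVar _))

/-- The values of a condition satisfy `A`. -/
theorem instA_of_cond {p x y : Term HAHPLang Γ 0} (hp : Θ ⊢ₕ cond A p)
    (h : Θ ⊢ₕ .eq (app p x) (𝐒 y)) : Θ ⊢ₕ instA A x y := by
  have hx := defd_app_right h.defdEq₁
  refine or_elim (cond_cases hp hx)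
    (fun Θ₁ w₁ h₀ => succ_ne_zero (eq_trans (eq_symm (w₁ h)) h₀)) fun Θ₁ w₁ h₁ => ?_
  refine ex_elim h₁ fun Θ₂ w₂ h₁ => ?_
  have h := w₂ (w₁ h)
  have hx := w₂ (w₁ hx)
  simp at h hx h₁ ⊢
  exact instA_congr (.eqI hx) (succ_inj (eq_trans (eq_symm h₁.andE₁) h)) h₁.andE₂

/-- A condition that is undefined at `x` can be extended by any `y` with `A[x, y]`. -/
theorem ext_isUpdate {q x y r : Term HAHPLang Γ 0} (hq : Θ ⊢ₕ cond A q)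
    (h₀ : Θ ⊢ₕ .eq (app q x) 𝐎) (hy : Θ ⊢ₕ .defd y) (hA : Θ ⊢ₕ instA A x y)
    (h : Θ ⊢ₕ isUpdate q x (𝐒 y) r) : Θ ⊢ₕ ext A r q := by
  have hr := isUpdate_total h (cond_total hq)
  refine .andI (.andI (defd_of_total hr) (all_intro fun Θ₁ w₁ => ?_))
    (extend_intro fun Θ₁ w₁ hz => ?_)
  · have hq := w₁ hq
    have hr := w₁ hr
    have hA := w₁ hA
    have h := w₁ h
    have hy := w₁ hy
    have hz : Θ₁ ⊢ₕ .defd (.var .zero) := .defdVar _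
    simp at hq hr hA h hy ⊢
    refine or_elim (isUpdate_cases h hz) (fun Θ₂ w₂ hx => .orI₂ ?_) fun Θ₂ w₂ hx => ?_
    · refine ex_intro _ (w₂ hy) ?_
      simp
      exact .andI (eq_trans (app_congr (.eqI (w₂ (defd_of_total hr))) hx
        (w₂ (total_elim hr hz))) (w₂ h).andE₁) (instA_congr (eq_symm hx) (.eqI (w₂ hy)) (w₂ hA))
    · refine or_elim (cond_cases (w₂ hq) (w₂ hz)) (fun Θ₃ w₃ h₀ => .orI₁ (eq_trans (w₃ hx) h₀))
        fun Θ₃ w₃ h₁ => .orI₂ ?_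
      refine ex_elim h₁ fun Θ₄ w₄ h₁ => ?_
      have hx := w₄ (w₃ hx)
      simp at h₁ hx ⊢
      refine ex_intro (.var .zero) (.defdVar _) ?_
      simp
      exact .andI (eq_trans hx h₁.andE₁) h₁.andE₂
  · have h := w₁ h
    have h₀ := w₁ h₀
    have hq := w₁ (defd_of_total (cond_total hq))
    simp at h h₀ hq
    -- A positive value of `q` cannot sit at the updated argument, because `q` is `0` there; at all
    -- other arguments the value is unchanged.
    refine or_elim (isUpdate_cases h (.defdVar (.succ .zero))) (fun Θ₂ w₂ hx => ?_)
      fun Θ₂ w₂ hx => eq_trans hx (w₂ hz)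
    have := app_congr (.eqI (w₂ hq)) hx (w₂ hz).defdEq₁
    exact succ_ne_zero (eq_trans (eq_symm (w₂ hz)) (eq_trans this (w₂ h₀)))

/-- The density fact behind the second axiom for `R`. Either `q` already has a positive value at
`x`, possibly other than `S y`, and serves itself; or its value there is `0` and the update with
value `S y` is a condition below it. -/
theorem exBelow_defined {q x y : Term HAHPLang Γ 0} (hq : Θ ⊢ₕ cond A q) (hx : Θ ⊢ₕ .defd x)
    (hy : Θ ⊢ₕ .defd y) (hA : Θ ⊢ₕ instA A x y) :
    Θ ⊢ₕ exBelow A q (.ex 0 (.eq (app (.var (.succ .zero))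
      (x.subst ((Sub.shift 0).comp (Sub.shift 0)))) (𝐒 (.var .zero)))) := by
  refine or_elim (cond_cases hq hx) (fun Θ₁ w₁ h₀ => ?_) fun Θ₁ w₁ h => ?_
  · refine ex_elim (updatable_elim (w₁ (updatable_of_defd hx)) (w₁ (cond_total hq))
      (w₁ (defd_succ hy))) fun Θ₂ w₂ hr => ?_
    have hq := w₂ (w₁ hq)
    have hy := w₂ (w₁ hy)
    have hA := w₂ (w₁ hA)
    have h₀ := w₂ h₀
    simp at hq hy hA h₀ hr ⊢
    refine exBelow_intro (ext_isUpdate hq h₀ hy hA hr) (ex_intro _ (by simpa using hy) ?_)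
    simpa using hr.andE₁
  · refine ex_elim h fun Θ₂ w₂ h => ?_
    have hq := w₂ (w₁ hq)
    simp at hq h ⊢
    refine exBelow_intro (ext_refl hq) (ex_intro (.var .zero) (by exact .defdVar _) ?_)
    simpa using h.andE₁

end Conditions

/-! ### The forcing translation -/

/-- Substitution in a term over the language with `R`, which has no new function symbols. -/
def Term.tr {Γ Δ : List ℕ} (σ : Sub HAHPLang Γ Δ) :
    {n : ℕ} → Term HAHPRLang Γ n → Term HAHPLang Δ n
  | _, .var x => σ _ x
  | _, .fn f args => .fn (L := HAHPLang) f (fun i => (args i).tr σ)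

/-- A substitution over the language with `R` followed by a substitution. -/
def Sub.tr {Γ Δ E : List ℕ} (τ : Sub HAHPRLang Γ Δ) (σ : Sub HAHPLang Δ E) : Sub HAHPLang Γ E :=
  fun n x => (τ n x).tr σ

theorem Term.tr_subst {Γ Δ E : List ℕ} (σ : Sub HAHPLang Γ Δ) (τ : Sub HAHPLang Δ E) {n : ℕ}
    (t : Term HAHPRLang Γ n) : (t.tr σ).subst τ = t.tr (σ.comp τ) := by
  induction t with
  | var x => rfl
  | fn f args ih =>
    exact congrArg (Term.fn (L := HAHPLang) f) (funext ih)

theorem Term.subst_tr {Γ Δ E : List ℕ} (τ : Sub HAHPRLang Γ Δ) (σ : Sub HAHPLang Δ E) {n : ℕ}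
    (t : Term HAHPRLang Γ n) : (t.subst τ).tr σ = t.tr (τ.tr σ) := by
  induction t with
  | var x => rfl
  | fn f args ih =>
    exact congrArg (Term.fn (L := HAHPLang) f) (funext ih)

theorem Term.map_tr {Γ Δ : List ℕ} (σ : Sub HAHPLang Γ Δ) {n : ℕ}
    (t : Term HAHPLang Γ n) : (t.map HAHPLang.toHAHPR).tr σ = t.subst σ := by
  induction t with
  | var x => rfl
  | fn f args ih =>
    exact congrArg (Term.fn (L := HAHPLang) f) (funext ih)

theorem Sub.tr_comp {Γ Δ E F : List ℕ} (τ : Sub HAHPRLang Γ Δ) (σ : Sub HAHPLang Δ E)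
    (υ : Sub HAHPLang E F) : (τ.tr σ).comp υ = τ.tr (σ.comp υ) := by
  funext n x; exact Term.tr_subst _ _ _

theorem Sub.comp_tr {Γ Δ E F : List ℕ} (τ : Sub HAHPRLang Γ Δ) (υ : Sub HAHPRLang Δ E)
    (σ : Sub HAHPLang E F) : (τ.comp υ).tr σ = τ.tr (υ.tr σ) := by
  funext n x; exact Term.subst_tr _ _ _

theorem Sub.id_tr {Γ Δ : List ℕ} (σ : Sub HAHPLang Γ Δ) : Sub.id.tr σ = σ := rfl

theorem Sub.shift_tr_cons {Γ Δ : List ℕ} {m : ℕ} (a : Term HAHPLang Δ m)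
    (σ : Sub HAHPLang Γ Δ) : (Sub.shift m).tr (Sub.cons a σ) = σ := rfl

theorem Sub.cons_tr {Γ Δ E : List ℕ} {m : ℕ} (a : Term HAHPRLang Δ m)
    (τ : Sub HAHPRLang Γ Δ) (σ : Sub HAHPLang Δ E) :
    (Sub.cons a τ).tr σ = Sub.cons (a.tr σ) (τ.tr σ) := by
  funext n x; cases x <;> rfl

theorem Term.var_zero_tr_cons {Γ Δ : List ℕ} {m : ℕ} (a : Term HAHPLang Δ m)
    (σ : Sub HAHPLang Γ Δ) : (Term.var Var.zero : Term HAHPRLang (m :: Γ) m).tr (Sub.cons a σ) = a :=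
  rfl

theorem Term.var_succ_tr_cons {Γ Δ : List ℕ} {m n : ℕ} (a : Term HAHPLang Δ m)
    (σ : Sub HAHPLang Γ Δ) (x : Var Γ n) :
    (Term.var (Var.succ x) : Term HAHPRLang (m :: Γ) n).tr (Sub.cons a σ) = (Term.var x).tr σ :=
  rfl

theorem zero_tr {Γ Δ : List ℕ} (σ : Sub HAHPLang Γ Δ) :
    (zero HAHLang.toHAHPR).tr σ = 𝐎 :=
  congrArg (Term.fn (L := HAHPLang) (.ofHAH .zero)) (args0_eq _)

theorem succ_tr {Γ Δ : List ℕ} (σ : Sub HAHPLang Γ Δ) (a : Term HAHPRLang Γ 0) :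
    (succ HAHLang.toHAHPR a).tr σ = 𝐒 (a.tr σ) :=
  congrArg (Term.fn (L := HAHPLang) (.ofHAH .succ)) (args1_eq _)

attribute [simp] Term.tr_subst Term.subst_tr Term.map_tr Sub.tr_comp Sub.comp_tr Sub.id_tr
  Sub.shift_tr_cons Sub.cons_tr Term.var_zero_tr_cons Term.var_succ_tr_cons zero_tr succ_tr

section Forcing

variable (A : Formula HAHLang [0, 0])

/-- The condition `p` forces the atomic formula with the new relation symbol. -/
def forceRel {Δ : List ℕ} (p : Term HAHPLang Δ 0) : {l : List ℕ} → RSymbol l →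
    (∀ i : Fin l.length, Term HAHPLang Δ (l.get i)) → Formula HAHPLang Δ
  | _, .R, args => dense A p (.eq (app v0 ((args ⟨0, Nat.zero_lt_two⟩).subst (Sub.shift 0)))
      (𝐒 ((args ⟨1, Nat.one_lt_two⟩).subst (Sub.shift 0))))

/-- The condition `p` forces a formula of the language with `R`, under the assignment `σ`. -/
def force {Δ : List ℕ} (p : Term HAHPLang Δ 0) :
    {Γ : List ℕ} → Sub HAHPLang Γ Δ → Formula HAHPRLang Γ → Formula HAHPLang Δ
  | _, σ, .defd a => .defd (a.tr σ)
  | _, σ, .eq a b => .eq (a.tr σ) (b.tr σ)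
  | _, σ, .mem a b => .mem (a.tr σ) (b.tr σ)
  | _, σ, .rel S args => forceRel A p S (fun i => (args i).tr σ)
  | _, _, .bot => .bot
  | _, _, .top => .top
  | _, σ, .or B C => dense A p
      (.or (force v0 (σ.comp (Sub.shift 0)) B) (force v0 (σ.comp (Sub.shift 0)) C))
  | _, σ, .and B C => .and (force p σ B) (force p σ C)
  | _, σ, .imp B C => below A p
      (.imp (force v0 (σ.comp (Sub.shift 0)) B) (force v0 (σ.comp (Sub.shift 0)) C))
  | _, σ, .ex n B => dense A p
      (.ex n (force v1 (Sub.cons v0 (σ.comp (.comp (Sub.shift 0) (Sub.shift n)))) B))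
  | _, σ, .all n B =>
      .all n (force (p.subst (Sub.shift n)) (Sub.cons v0 (σ.comp (Sub.shift n))) B)

variable {A}

theorem forceRel_subst {Δ E : List ℕ} (p : Term HAHPLang Δ 0) {l : List ℕ} (S : RSymbol l)
    (args : ∀ i : Fin l.length, Term HAHPLang Δ (l.get i)) (τ : Sub HAHPLang Δ E) :
    (forceRel A p S args).subst τ = forceRel A (p.subst τ) S (fun i => (args i).subst τ) := by
  cases S; simp [forceRel]

@[simp]
theorem force_subst {Γ Δ E : List ℕ} (B : Formula HAHPRLang Γ) (p : Term HAHPLang Δ 0)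
    (σ : Sub HAHPLang Γ Δ) (τ : Sub HAHPLang Δ E) :
    (force A p σ B).subst τ = force A (p.subst τ) (σ.comp τ) B := by
  induction B generalizing Δ E with
  | rel S args =>
    exact (forceRel_subst p S _ τ).trans (congrArg _ (funext fun i => Term.tr_subst _ _ _))
  | _ => simp_all [force]

@[simp]
-- Since assignments consist of terms, a substitution inside the forced formula is just a change of
-- assignment. The soundness of the quantifier and equality rules rests on this.
theorem subst_force {Γ Γ' Δ : List ℕ} (B : Formula HAHPRLang Γ) (p : Term HAHPLang Δ 0)
    (τ : Sub HAHPRLang Γ Γ') (σ : Sub HAHPLang Γ' Δ) :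
    force A p σ (B.subst τ) = force A p (τ.tr σ) B := by
  induction B generalizing Γ' Δ <;> simp_all [force]

variable {Γ Δ : List ℕ} {Θ : List (Formula HAHPLang Δ)}

/-! ### Monotonicity, locality and absoluteness of forcing -/

theorem force_all_elim {p : Term HAHPLang Δ 0} {σ : Sub HAHPLang Γ Δ} {n : ℕ}
    {B : Formula HAHPRLang (n :: Γ)} (h : Θ ⊢ₕ force A p σ (.all n B)) {a : Term HAHPLang Δ n}
    (ha : Θ ⊢ₕ .defd a) : Θ ⊢ₕ force A p (Sub.cons a σ) B := by
  simpa using all_elim h a ha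

theorem force_imp_elim {p q : Term HAHPLang Δ 0} {σ : Sub HAHPLang Γ Δ}
    {B C : Formula HAHPRLang Γ} (h : Θ ⊢ₕ force A p σ (.imp B C)) (hq : Θ ⊢ₕ ext A q p)
    (hB : Θ ⊢ₕ force A q σ B) : Θ ⊢ₕ force A q σ C := by
  have := below_elim h hq
  simp at this
  exact .impE this hB

/-- Most clauses either ignore the condition or quantify over all conditions below it, so they pass
down by transitivity; only conjunction and universal quantification need the induction hypothesis.
-/
theorem force_mono (B : Formula HAHPRLang Γ) {p q : Term HAHPLang Δ 0} {σ : Sub HAHPLang Γ Δ}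
    (hq : Θ ⊢ₕ ext A q p) (h : Θ ⊢ₕ force A p σ B) : Θ ⊢ₕ force A q σ B := by
  induction B generalizing Δ with
  | defd a => exact h
  | eq a b => exact h
  | mem a b => exact h
  | rel S args =>
    cases S
    exact dense_ext h hq
  | bot => exact h
  | top => exact h
  | or B C => exact dense_ext h hq
  | and B C ihB ihC => exact .andI (ihB hq h.andE₁) (ihC hq h.andE₂)
  | imp B C => exact below_ext h hq
  | ex n B => exact dense_ext h hq
  | all n B ih =>
    refine all_intro fun Θ₁ w₁ => ?_
    have h := w₁ h
    have hq := w₁ hq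
    simp only [force_subst, ext_subst] at h hq
    exact ih hq (force_all_elim h (.defdVar _))

/-- The clauses for `R`, disjunction and existence are density statements, so nested density
collapses; the condition-free clauses follow because some smaller condition exists. Locality is what
validates the elimination rules for disjunction and existence, whose premises hold only densely. -/
theorem force_local (B : Formula HAHPRLang Γ) {p : Term HAHPLang Δ 0} {σ : Sub HAHPLang Γ Δ}
    (hp : Θ ⊢ₕ cond A p)
    (h : Θ ⊢ₕ dense A p (force A (.var .zero) (σ.comp (Sub.shift 0)) B)) :
    Θ ⊢ₕ force A p σ B := by
  induction B generalizing Δ with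
  | defd a => exact dense_const hp (by simpa [force] using h)
  | eq a b => exact dense_const hp (by simpa [force] using h)
  | mem a b => exact dense_const hp (by simpa [force] using h)
  | rel S args =>
    cases S
    exact dense_join (by simpa [force, forceRel] using h)
  | bot => exact dense_const hp h
  | top => exact .topI
  | or B C => exact dense_join (by simpa [force] using h)
  | and B C ihB ihC =>
    exact .andI
      (ihB hp (dense_map h (below_intro fun _ _ _ => imp_intro fun _ _ h => h.andE₁)))
      (ihC hp (dense_map h (below_intro fun _ _ _ => imp_intro fun _ _ h => h.andE₂)))
  | imp B C ihB ihC =>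
    refine below_intro fun Θ₁ w₁ hq => imp_intro fun Θ₂ w₂ hB => ?_
    have h := w₂ (w₁ h)
    simp only [dense_subst] at h
    -- Densely many `r` below `q` force the implication. By monotonicity they also force `B`, hence
    -- `C`, and locality of `C` returns the conclusion to `q`.
    refine ihC (w₂ hq.andE₁) (dense_map (dense_ext h (w₂ hq))
      (below_intro fun Θ₃ w₃ hr => imp_intro fun Θ₄ w₄ hBC => ?_))
    have hB := w₄ (w₃ hB)
    simp at hB hBC ⊢
    exact force_imp_elim hBC (ext_refl (w₄ hr.andE₁)) (force_mono B (w₄ hr) hB)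
  | ex n B => exact dense_join (by simpa [force] using h)
  | all n B ih =>
    refine all_intro fun Θ₁ w₁ => ?_
    have hp := w₁ hp
    have h := w₁ h
    simp only [dense_subst, cond_subst] at h hp
    refine ih hp (dense_map h (below_intro fun Θ₂ w₂ hq => imp_intro fun Θ₃ w₃ hB => ?_))
    simp at hB ⊢
    exact force_all_elim hB (.defdVar _)

/-- A formula follows if it is forced after passing to densely many conditions with `F`. -/
theorem force_of_dense (B : Formula HAHPRLang Γ) {p : Term HAHPLang Δ 0}
    {σ : Sub HAHPLang Γ Δ} {F : Formula HAHPLang (0 :: Δ)} (hp : Θ ⊢ₕ cond A p)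
    (h : Θ ⊢ₕ dense A p F)
    (d : ∀ Θ' : List (Formula HAHPLang (0 :: Δ)),
      (∀ {C}, Θ ⊢ₕ C → Θ' ⊢ₕ C.subst (Sub.shift 0)) →
      Θ' ⊢ₕ ext A (.var .zero) (p.subst (Sub.shift 0)) → Θ' ⊢ₕ F →
      Θ' ⊢ₕ force A (.var .zero) (σ.comp (Sub.shift 0)) B) : Θ ⊢ₕ force A p σ B :=
  force_local B hp (dense_map h (below_intro fun _ w₁ hq => imp_intro fun Θ₂ w₂ hF =>
    d Θ₂ (fun hC => w₂ (w₁ hC)) (w₂ hq) hF))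

/-- Formulas without `R` are forced if and only if they hold. -/
theorem force_map_iff (B : Formula HAHPLang Γ) {p : Term HAHPLang Δ 0} {σ : Sub HAHPLang Γ Δ}
    (hp : Θ ⊢ₕ cond A p) :
    Θ ⊢ₕ force A p σ (B.map HAHPLang.toHAHPR) ↔ Θ ⊢ₕ B.subst σ := by
  induction B generalizing Δ with
  | defd a => simp [force, Formula.map]
  | eq a b => simp [force, Formula.map]
  | mem a b => simp [force, Formula.map]
  | rel S args => nomatch S
  | bot => rfl
  | top => rfl
  | or B C ihB ihC =>
    constructor
    -- Some condition below `p` decides the disjunction, and the decided disjunct holds outright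
    -- because it is free of `R`.
    · refine fun h => dense_elim h (ext_refl hp) fun Θ₁ w₁ hq h => ?_
      simp
      exact or_elim h (fun _ w h => .orI₁ ((ihB (w hq.andE₁)).1 h))
        fun _ w h => .orI₂ ((ihC (w hq.andE₁)).1 h)
    · refine fun h => dense_of_below (below_intro fun Θ₁ w₁ hq => ?_)
      have h := w₁ h
      simp at h
      exact or_elim h (fun _ w h => .orI₁ ((ihB (w hq.andE₁)).2 h))
        fun _ w h => .orI₂ ((ihC (w hq.andE₁)).2 h)
  | and B C ihB ihC =>
    exact ⟨fun h => .andI ((ihB hp).1 h.andE₁) ((ihC hp).1 h.andE₂),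
      fun h => .andI ((ihB hp).2 h.andE₁) ((ihC hp).2 h.andE₂)⟩
  | imp B C ihB ihC =>
    constructor
    · exact fun h => imp_intro fun Θ₁ w hB =>
        (ihC (w hp)).1 (force_imp_elim (w h) (ext_refl (w hp)) ((ihB (w hp)).2 hB))
    · refine fun h => below_intro fun Θ₁ w₁ hq => imp_intro fun Θ₂ w₂ hB => ?_
      have h := w₂ (w₁ h)
      simp at h
      exact (ihC (w₂ hq.andE₁)).2 (.impE h ((ihB (w₂ hq.andE₁)).1 hB))
  | ex n B ih =>
    constructor
    · refine fun h => dense_elim h (ext_refl hp) fun Θ₁ w₁ hq h => ?_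
      refine ex_elim h fun Θ₂ w₂ h => ?_
      have hq := w₂ hq.andE₁
      simp only [cond_subst, Term.var_subst_shift] at hq
      have := (ih hq).1 h
      refine ex_intro (.var .zero) (.defdVar _) ?_
      simpa using this
    · refine fun h => dense_of_below (below_intro fun Θ₁ w₁ hq => ?_)
      refine ex_elim (w₁ h) fun Θ₂ w₂ h => ?_
      have hq := w₂ hq.andE₁
      simp only [cond_subst, Term.var_subst_shift] at hq
      refine ex_intro (.var .zero) (.defdVar _) ?_
      simp
      refine (ih hq).2 ?_
      simpa using h
  | all n B ih =>
    constructor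
    · refine fun h => all_intro fun Θ₁ w₁ => ?_
      have hp := w₁ hp
      have h := w₁ h
      simp only [cond_subst, force_subst] at hp h
      simpa using (ih hp).1 (force_all_elim h (.defdVar .zero))
    · refine fun h => all_intro fun Θ₁ w₁ => ?_
      have hp := w₁ hp
      have h := w₁ h
      simp only [cond_subst] at hp
      refine (ih hp).2 ?_
      simpa using all_elim h (.var .zero) (.defdVar _)

end Forcing

/-! ### Soundness of forcing -/

section Soundness

variable {A : Formula HAHLang [0, 0]} {Γ Δ : List ℕ} {Θ : List (Formula HAHPLang Δ)}

/-- In the context `Θ`, the condition `p` forces the formulas `Ξ` under an assignment of existing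
objects. -/
structure ForcesContext (A : Formula HAHLang [0, 0]) (Θ : List (Formula HAHPLang Δ))
    (p : Term HAHPLang Δ 0) (σ : Sub HAHPLang Γ Δ) (Ξ : List (Formula HAHPRLang Γ)) : Prop where
  cond : Θ ⊢ₕ cond A p
  defd : ∀ (n : ℕ) (x : Var Γ n), Θ ⊢ₕ .defd (σ n x)
  forces : ∀ B ∈ Ξ, Θ ⊢ₕ force A p σ B

namespace ForcesContext

variable {p : Term HAHPLang Δ 0} {σ : Sub HAHPLang Γ Δ} {Ξ : List (Formula HAHPRLang Γ)}

theorem shift (h : ForcesContext A Θ p σ Ξ) {m : ℕ} {Θ' : List (Formula HAHPLang (m :: Δ))}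
    (w : ∀ {B}, Θ ⊢ₕ B → Θ' ⊢ₕ B.subst (Sub.shift m)) :
    ForcesContext A Θ' (p.subst (Sub.shift m)) (σ.comp (Sub.shift m)) Ξ where
  cond := by simpa using w h.cond
  defd n x := w (h.defd n x)
  forces B hB := by simpa using w (h.forces B hB)

theorem mono (h : ForcesContext A Θ p σ Ξ) {Θ' : List (Formula HAHPLang Δ)}
    (w : ∀ {B}, Θ ⊢ₕ B → Θ' ⊢ₕ B) : ForcesContext A Θ' p σ Ξ where
  cond := w h.cond
  defd n x := w (h.defd n x)
  forces B hB := w (h.forces B hB)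

theorem ext (h : ForcesContext A Θ p σ Ξ) {q : Term HAHPLang Δ 0} (hq : Θ ⊢ₕ ext A q p) :
    ForcesContext A Θ q σ Ξ where
  cond := hq.andE₁
  defd := h.defd
  forces B hB := force_mono B hq (h.forces B hB)

theorem push (h : ForcesContext A Θ p σ Ξ) {B : Formula HAHPRLang Γ}
    (hB : Θ ⊢ₕ force A p σ B) : ForcesContext A Θ p σ (B :: Ξ) where
  cond := h.cond
  defd := h.defd
  forces C hC := by
    rcases List.mem_cons.1 hC with rfl | hC
    · exact hB
    · exact h.forces C hC

theorem bind (h : ForcesContext A Θ p σ Ξ) {n : ℕ} {a : Term HAHPLang Δ n}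
    (ha : Θ ⊢ₕ .defd a) :
    ForcesContext A Θ p (Sub.cons a σ) (Ξ.map (Formula.weaken n)) where
  cond := h.cond
  defd k x := by
    cases x with
    | zero => exact ha
    | succ x => exact h.defd k x
  forces C hC := by
    obtain ⟨B, hB, rfl⟩ := List.mem_map.1 hC
    simpa using h.forces B hB

end ForcesContext

/-- As `A` does not mention `R`, it comes from a formula of HAHP, so forcing it is the same as its
truth by `force_map_iff`. -/
theorem liftA_eq (A : Formula HAHLang [0, 0]) :
    (liftA A : Formula HAHPRLang (0 :: 0 :: Γ)) =
      (instA A (.var (.succ .zero)) (.var .zero)).map HAHPLang.toHAHPR := by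
  have h : ∀ {Γ : List ℕ} (B : Formula HAHLang Γ),
      (B.map HAHLang.toHAHP).map HAHPLang.toHAHPR = B.map HAHLang.toHAHPR := by
    have ht : ∀ {Γ : List ℕ} {n : ℕ} (t : Term HAHLang Γ n),
        (t.map HAHLang.toHAHP).map HAHPLang.toHAHPR = t.map HAHLang.toHAHPR := by
      intro Γ n t
      induction t with
      | var x => rfl
      | fn f args ih => exact congrArg (Term.fn (L := HAHPRLang) (.ofHAH f)) (funext ih)
    intro Γ B
    induction B with
    | rel S args => nomatch S
    | _ => simp_all [Formula.map]
  rw [liftA, instA, Formula.map_subst, h, Formula.rename_eq_subst]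
  congr 1
  funext n x
  match x with
  | .zero => rfl
  | .succ .zero => rfl

/-- The condition `p` forces `R(a, b)` if it has value `S b` at `a`. -/
theorem force_relR {p : Term HAHPLang Δ 0} {σ : Sub HAHPLang Γ Δ} {a b : Term HAHPRLang Γ 0}
    (h : Θ ⊢ₕ .eq (app p (a.tr σ)) (𝐒 (b.tr σ))) : Θ ⊢ₕ force A p σ (relR a b) :=
  dense_of_below (below_intro fun Θ₁ w₁ hq => by
    have h := w₁ h
    simp at h
    simpa [args2] using extend_elim hq.andE₂ h)

theorem force_relR_elim {p : Term HAHPLang Δ 0} {σ : Sub HAHPLang Γ Δ} {a b : Term HAHPRLang Γ 0}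
    {C : Formula HAHPLang Δ} (hp : Θ ⊢ₕ cond A p) (h : Θ ⊢ₕ force A p σ (relR a b))
    (d : ∀ Θ' : List (Formula HAHPLang (0 :: Δ)),
      (∀ {B}, Θ ⊢ₕ B → Θ' ⊢ₕ B.subst (Sub.shift 0)) →
      Θ' ⊢ₕ ext A (.var .zero) (p.subst (Sub.shift 0)) →
      Θ' ⊢ₕ .eq (app (.var .zero) (a.tr (σ.comp (Sub.shift 0))))
        (𝐒 (b.tr (σ.comp (Sub.shift 0)))) → Θ' ⊢ₕ C.subst (Sub.shift 0)) : Θ ⊢ₕ C := by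
  refine dense_elim h (ext_refl hp) fun Θ₁ w₁ hq h => d Θ₁ w₁ hq ?_
  simpa [args2] using h

/-- For a fixed condition, "`q` forces `B[x]`" is a formula of HAHP in the variable `x`, so the
induction scheme of HAHP applies to it. -/
theorem force_induction (B : Formula HAHPRLang (0 :: Γ)) (p : Term HAHPLang Δ 0)
    (σ : Sub HAHPLang Γ Δ) : Θ ⊢ₕ force A p σ (induction HAHLang.toHAHPR B) := by
  refine below_intro fun Θ₁ w₁ hq => imp_intro fun Θ₂ w₂ h => ?_
  simp only [v0] at h ⊢
  refine all_intro fun Θ₃ w₃ => ?_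
  have h₀ := w₃ h.andE₁
  have h₁ := w₃ h.andE₂
  have hq := w₃ (w₂ hq.andE₁)
  simp only [force_subst] at h₀ h₁
  simp at hq h₀
  have := induct (Θ := Θ₃) (force A (.var (.succ (.succ .zero)))
    (Sub.cons (.var .zero) (σ.comp ((Sub.shift 0).comp ((Sub.shift 0).comp (Sub.shift 0))))) B)
    (by simpa using h₀) (fun Θ₄ w₄ hB => by
      have h₁ := w₄ h₁
      have hq := w₄ hq
      simp only [force_subst] at h₁
      have h₂ := force_all_elim h₁ (.defdVar .zero)
      simp at h₂ hq
      -- The condition stays fixed along the induction: the induction step is used at the condition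
      -- itself.
      have := force_imp_elim h₂ (ext_refl hq) (by simpa using hB)
      simpa [Sub.succ_eq] using this) (.var .zero) (.defdVar _)
  simpa using this

/-- Pass to a condition with value `S y` at `x`, then to a smaller one with value `S y'`. The latter
retains the first value, so injectivity of the successor gives `y = y'`, an equation that does not
depend on the condition. -/
theorem force_functional (p : Term HAHPLang Δ 0) (σ : Sub HAHPLang Γ Δ) :
    Θ ⊢ₕ force A p σ (.all 0 (.all 0 (.all 0
      (.imp (.and (relR v2 v1) (relR v2 v0)) (.eq v1 v0))))) := by
  refine all_intro fun Θ₁ w₁ => all_intro fun Θ₂ w₂ => all_intro fun Θ₃ w₃ =>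
    below_intro fun Θ₄ w₄ hq => imp_intro fun Θ₅ w₅ h => ?_
  have hq := w₅ hq.andE₁
  refine force_relR_elim hq h.andE₁ fun Θ₆ w₆ hr h₁ => ?_
  have h₂ := w₆ h.andE₂
  rw [force_subst] at h₂
  have h₂ := force_mono _ hr h₂
  refine force_relR_elim hr.andE₁ h₂ fun Θ₇ w₇ hr' h₂ => ?_
  have h₁ := w₇ h₁
  simp [force] at h₁ h₂ hr' ⊢
  exact succ_inj (eq_trans (eq_symm (extend_elim hr'.andE₂ h₁)) h₂)

theorem force_inhabited (p : Term HAHPLang Δ 0) (σ : Sub HAHPLang Γ Δ) :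
    Θ ⊢ₕ force A p σ (.all 0 (.imp (.ex 0 (liftA A)) (.ex 0 (relR v1 v0)))) := by
  refine all_intro fun Θ₁ w₁ => below_intro fun Θ₂ w₂ hq => imp_intro fun Θ₃ w₃ h => ?_
  have hq := w₃ hq.andE₁
  rw [liftA_eq] at h
  -- Forced existence of a value `y` with `A[x, y]` is actual existence, so such a `y` is available
  -- to extend any condition below.
  have h := (force_map_iff (.ex 0 (instA A (.var (.succ .zero)) (.var .zero))) hq).1 h
  refine below_intro fun Θ₄ w₄ hq' => ?_
  have h := w₄ h
  refine ex_elim h fun Θ₅ w₅ h => ?_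
  have hq' := w₅ hq'.andE₁
  simp at h hq' ⊢
  refine exBelow_elim (exBelow_defined hq' (.defdVar _) (.defdVar _) h) fun Θ₆ w₆ hr h => ?_
  simp at h hr ⊢
  refine exBelow_intro hr (ex_elim h fun Θ₇ w₇ h => ex_intro (.var .zero) (.defdVar _) ?_)
  simp
  exact force_relR (by simpa using h)

theorem force_sound (p : Term HAHPLang Δ 0) (σ : Sub HAHPLang Γ Δ) :
    Θ ⊢ₕ force A p σ (.all 0 (.all 0 (.imp (relR v1 v0) (liftA A)))) := by
  refine all_intro fun Θ₁ w₁ => all_intro fun Θ₂ w₂ => below_intro fun Θ₃ w₃ hq =>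
    imp_intro fun Θ₄ w₄ h => ?_
  have hq := w₄ hq.andE₁
  rw [liftA_eq]
  refine (force_map_iff _ hq).2 (force_relR_elim hq h fun Θ₅ w₅ hr h => ?_)
  simpa using instA_of_cond hr.andE₁ h

/-- The theorems of HAHP with `R` are forced. -/
theorem force_of_provable {Ξ : List (Formula HAHPRLang Γ)} {B : Formula HAHPRLang Γ}
    (d : Provable (HAHPR A) Ξ B) {p : Term HAHPLang Δ 0} {σ : Sub HAHPLang Γ Δ}
    (h : ForcesContext A Θ p σ Ξ) : Θ ⊢ₕ force A p σ B := by
  induction d generalizing Δ with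
  | ax hB =>
    cases hB with
    -- These axioms are free of `R`, so truth suffices; in particular comprehension requires no new
    -- sets.
    | hahp hB => exact (force_map_iff _ h.cond).2 (.ax (HAHPAxiom.subst hB σ))
    | ind B => exact force_induction B p σ
    | functional => exact force_functional p σ
    | inhabited => exact force_inhabited p σ
    | sound => exact force_sound p σ
  | hyp hB => exact h.forces _ hB
  | topI => exact .topI
  | botE _ ih => exact .botE (ih h)
  | andI _ _ ih₁ ih₂ => exact .andI (ih₁ h) (ih₂ h)
  | andE₁ _ ih => exact .andE₁ (ih h)
  | andE₂ _ ih => exact .andE₂ (ih h)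
  | orI₁ _ ih =>
    refine dense_of_below (below_intro fun Θ₁ w₁ hq => .orI₁ ?_)
    exact ih ((h.shift w₁).ext hq)
  | orI₂ _ ih =>
    refine dense_of_below (below_intro fun Θ₁ w₁ hq => .orI₂ ?_)
    exact ih ((h.shift w₁).ext hq)
  | orE _ _ _ ih ih₁ ih₂ =>
    -- The premise decides between the disjuncts only densely, and locality of the conclusion makes
    -- that enough.
    refine force_of_dense _ h.cond (ih h) fun Θ₁ w₁ hq hBC => ?_
    have h := (h.shift w₁).ext hq
    exact or_elim hBC (fun Θ₂ w₂ hB => ih₁ ((h.mono w₂).push hB))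
      fun Θ₂ w₂ hC => ih₂ ((h.mono w₂).push hC)
  | impI _ ih =>
    exact below_intro fun Θ₁ w₁ hq => imp_intro fun Θ₂ w₂ hB =>
      ih ((((h.shift w₁).ext hq).mono w₂).push hB)
  | impE _ _ ih₁ ih₂ => exact force_imp_elim (ih₁ h) (ext_refl h.cond) (ih₂ h)
  | allI _ ih => exact all_intro fun Θ₁ w₁ => ih ((h.shift w₁).bind (.defdVar _))
  | allE a _ _ ih₁ ih₂ => simpa using force_all_elim (ih₁ h) (ih₂ h)
  | exI a _ _ ih₁ ih₂ =>
    refine dense_of_below (below_intro fun Θ₁ w₁ hq => ?_)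
    have h := (h.shift w₁).ext hq
    exact ex_intro _ (ih₂ h) (by simpa using ih₁ h)
  | exE _ _ ih₁ ih₂ =>
    refine force_of_dense _ h.cond (ih₁ h) fun Θ₁ w₁ hq hB => ?_
    have h := (h.shift w₁).ext hq
    refine ex_elim hB fun Θ₂ w₂ hB => ?_
    have := ih₂ (((h.shift w₂).bind (.defdVar .zero)).push (by simpa using hB))
    simpa using this
  | eqI _ ih => exact .eqI (ih h)
  -- Forcing an equation is the equation itself, so replacement is carried out in HAHP, in the
  -- assignment of the innermost variable.
  | @eqE _ _ n a b B _ _ ih₁ ih₂ =>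
    have := eq_elim (force A (p.subst (Sub.shift n)) (Sub.cons v0 (σ.comp (Sub.shift n))) B)
      (ih₁ h) (by simpa using ih₂ h)
    simpa using this
  | defdVar x => exact h.defd _ x
  | defdFn i _ ih => exact .defdFn (L := HAHPLang) (args := fun i => Term.tr σ _) i (ih h)
  | @defdRel _ _ l S args i _ ih =>
    cases S
    -- Any condition `r` below with `r a = S b` shows, by strictness of application and successor,
    -- that `a` and `b` are defined.
    refine dense_elim (ih h) (ext_refl h.cond) fun Θ₁ w₁ _ h' => ?_
    match i with
    | ⟨0, _⟩ => exact defd_app_right h'.defdEq₁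
    | ⟨1, _⟩ => exact defd_of_defd_succ h'.defdEq₂
  | defdEq₁ _ ih => exact .defdEq₁ (ih h)
  | defdEq₂ _ ih => exact .defdEq₂ (ih h)
  | defdMem₁ _ ih => exact .defdMem₁ (ih h)
  | defdMem₂ _ ih => exact .defdMem₂ (ih h)

end Soundness

/-- HAHP with `R` is a conservative extension of HAHP. -/
theorem HAHPR.isConservativeExtension (A : Formula HAHLang [0, 0]) :
    Theory.IsConservativeExtension HAHPLang.toHAHPR HAHP (HAHPR A) := by
  refine fun Γ B => ⟨fun d => ?_, fun d => d.map _ fun _ _ h => HAHPRAxiom.hahp h⟩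
  -- The identity assignment leaves the free variables of `B` as parameters, so open formulas are
  -- covered as well.
  have h := force_of_provable (Θ := []) (p := app kC 𝐎) (σ := Sub.id) d
    ⟨cond_empty, fun _ x => .defdVar x, by simp⟩
  rw [← Formula.subst_id B]
  exact (force_map_iff B cond_empty).1 h

end HOArith

theorem mainTheorem7 (A : HOArith.Formula HOArith.HAHLang [0, 0]) :
    HOArith.Theory.IsConservativeExtension HOArith.HAHPLang.toHAHPR HOArith.HAHP
      (HOArith.HAHPR A) := by
  exact HOArith.HAHPR.isConservativeExtension A
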